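/- \textbf{Setting.} Let $p\ge 1$, $K\ge 0$, let $\mathbf W_0=\mathbf I_p$ and let $\mathbf W_1,\dots,\mathbf W_K\in\mathbb R^{p\times p}$ be symmetric. Put $\boldsymbol\Sigma(\boldsymbol\beta)=\sum_{k=0}^K\beta_k\mathbf W_k$ for $\boldsymbol\beta\in\mathbb R^{K+1}$. Let $\mathbf y\in\mathbb R^p$ be a random vector with mean $\mathbf 0$ and covariance $\boldsymbol\Sigma_0=\boldsymbol\Sigma(\boldsymbol\beta^{(0)})$, let $\mathcal S=\{k:\beta^{(0)}_k\ne0\}$, $|\mathcal S|=s+1\ge1$, and $Q(\boldsymbol\beta)=\frac1{2p}\|\mathbf y\mathbf y^\top-\boldsymbol\Sigma(\boldsymbol\beta)\|_F^2$. For a vector $\mathbf v$ write $\|\mathbf v_{\mathcal S}\|_{\min}=\min_{k\in\mathcal S}|v_k|$; for a matrix, $\|\cdot\|_1$ is the maximal absolute column sum. The oracle estimator $\widehat{\boldsymbol\beta}^{\rm oracle}$ minimizes $Q$ over $\{\boldsymbol\beta:\boldsymbol\beta_{\mathcal S^c}=\mathbf 0\}$; a Lasso estimator $\widehat{\boldsymbol\beta}^{\rm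 lasso}$ minimizes $Q(\boldsymbol\beta)+\lambda_0\|\boldsymbol\beta\|_1$, $\lambda_0\ge0$. Let $a_1,a_2>0$, $\gamma>a_2$, $\lambda\ge0$, $a_0=\min\{1,a_2\}$. A folded concave penalty $p_\lambda$ satisfies: (i) $p_\lambda$ is nondecreasing and concave on $[0,\infty)$, $p_\lambda(0)=0$; (ii) $p_\lambda$ is differentiable on $(0,\infty)$ and $p_\lambda'(0):=p_\lambda'(0+)$ exists, is finite and is $\ge a_1\lambda$; (iii) $p'_\lambda(t)\ge a_1\lambda$ for $t\in(0,a_2\lambda]$; (iv) $p'_\lambda(t)=0$ for $t\ge\gamma\lambda$. The LLA algorithm starts at $\widehat{\boldsymbol\beta}^{(0)}=\widehat{\boldsymbol\beta}^{\rm initial}$ (a random vector) and, for $m\ge1$, takes for $\widehat{\boldsymbol\beta}^{(m)}$ a minimizer of $Q(\boldsymbol\beta)+\sum_{k=0}^Kp'_\lambda(|\widehat\beta^{(m-1)}_k|)\,|\beta_k|$. \textbf{Conditions.} Here $\tau_{\min},c,\sigma_{\min},w,\sigma_{\max},\kappa$ are positive constants. (C1) $\|\boldsymbol\beta^{(0)}_{\mathcal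 S}\|_{\min}>(\gamma+1)\lambda$. (C2) $\lambda_{\min}\big(p^{-1}\{\mathrm{tr}(\mathbf W_k\mathbf W_l)\}_{k,l\in\mathcal S}\big)\ge\tau_{\min}$. (C3) $\mathbf y=\boldsymbol\Sigma_0^{1/2}\mathbf Z$, where the coordinates of $\mathbf Z$ are i.i.d. with mean $0$, variance $1$ and $E e^{tZ_j}\le e^{c^2t^2/2}$ for all $t$; and $\lambda_{\min}(\boldsymbol\Sigma_0)>\sigma_{\min}$. (C4) $\|\mathbf W_k\|_1\le w$ for all $k$, and $\|\boldsymbol\Sigma_0^{1/2}\|_1\le\sigma_{\max}^{1/2}$. (C5) $\frac1p\|\sum_k\delta_k\mathbf W_k\|_F^2\ge\kappa\|\boldsymbol\delta\|_2^2$ whenever $\|\boldsymbol\delta_{\mathcal S^c}\|_1\le3\|\boldsymbol\delta_{\mathcal S}\|_1$. \textbf{Theorem.} (a) Assume (C1) and (C2). Then with probability at least $1-\delta_0-\delta_1-\delta_2$ the LLA algorithm initialized at $\widehat{\boldsymbol\beta}^{\rm initial}$ converges to $\widehat{\boldsymbol\beta}^{\rm oracle}$ after two iterations (the first iterate, the second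 iterate and all later ones are equal to $\widehat{\boldsymbol\beta}^{\rm oracle}$), where $$\delta_0=P\big(\|\widehat{\boldsymbol\beta}^{\rm initial}-\boldsymbol\beta^{(0)}\|_\infty>a_0\lambda\big),\quad \delta_1=P\big(\max_{k\in\mathcal S^c}|\partial_kQ(\widehat{\boldsymbol\beta}^{\rm oracle})|\ge a_1\lambda\big),\quad \delta_2=P\big(\|\widehat{\boldsymbol\beta}^{\rm oracle}_{\mathcal S}\|_{\min}<\gamma\lambda\big)$$ (the event in $\delta_1$ is empty if $\mathcal S^c=\emptyset$). (b) There are constants $C_1,\dots,C_8>0$ depending only on $c$ such that the following holds. Assume (C1)--(C5), let $\widehat{\boldsymbol\beta}^{\rm initial}=\widehat{\boldsymbol\beta}^{\rm lasso}$ and $\lambda\ge 3\sqrt{s+1}\,\lambda_0/(a_0\kappa)$. Then $$\delta_0\le2(K+1)\exp\Big\{-\min\Big(\frac{C_1p\lambda_0^2}{w^2\sigma_{\max}^2},\frac{C_2p\lambda_0}{w\sigma_{\max}}\Big)\Big\},$$ $$\delta_1\le2(K-s)\exp\Big\{-\min\Big(\frac{C_3a_1^2p\lambda^2}{w^2\sigma_{\max}^2},\frac{C_4a_1p\lambda}{w\sigma_{\max}}\Big)\Big\}+2(K-s)(s+1)\exp\Big\{-\min\Big(\frac{C_5a_1^2\tau_{\min}^2p\lambda^2}{w^6\sigma_{\max}^2(s+1)^2},\frac{C_6a_1\tau_{\min}p\lambda}{w^3\sigma_{\max}(s+1)}\Big)\Big\},$$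 $$\delta_2\le2(s+1)\exp\Big\{-\min\Big(\frac{C_7\tau_{\min}^2p(\|\boldsymbol\beta^{(0)}_{\mathcal S}\|_{\min}-\gamma\lambda)^2}{w^2\sigma_{\max}^2(s+1)},\frac{C_8\tau_{\min}p(\|\boldsymbol\beta^{(0)}_{\mathcal S}\|_{\min}-\gamma\lambda)}{w\sigma_{\max}(s+1)^{1/2}}\Big)\Big\}.$$ (c) Consider a sequence of such models with $p\to\infty$, in which $K,s,\mathbf W_k,\boldsymbol\beta^{(0)},\lambda,\lambda_0$ may vary, and which all satisfy the assumptions of (b) with the same constants $a_1,a_2,\gamma,\tau_{\min},c,\sigma_{\min},w,\sigma_{\max},\kappa$. If $p\lambda_0^2/\big(\max\{s,1\}\log\max\{K,2\}\big)\to\infty$ (that is, $p\lambda_0^2/\{s\log K\}\to\infty$ when $s\ge1$ and $K\ge2$), then $\delta_0+\delta_1+\delta_2\to0$. -/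

import Mathlib

open MeasureTheory ProbabilityTheory Filter Topology
open scoped NNReal

noncomputable section

/-- Smallest eigenvalue of a real symmetric matrix: the minimum of its (finite, real) spectrum. -/
def lambdaMin {n : Type*} [Fintype n] [DecidableEq n] (A : Matrix n n ℝ) : ℝ :=
  sInf (spectrum ℝ A)

/-- Maximal absolute column sum `max_j ∑_i |a_ij|`. -/
def matOneNorm {m n : Type*} [Fintype m] [Fintype n] (A : Matrix m n ℝ) : ℝ :=
  ⨆ j, ∑ i, |A i j|

/-- Squared Frobenius norm. -/
def frobSq {m n : Type*} [Fintype m] [Fintype n] (A : Matrix m n ℝ) : ℝ :=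
  ∑ i, ∑ j, A i j ^ 2

/-- The symmetric positive semidefinite square root of a positive semidefinite matrix
(functional calculus). -/
def matSqrt {n : Type*} [Fintype n] [DecidableEq n] (A : Matrix n n ℝ) : Matrix n n ℝ :=
  cfc Real.sqrt A

/-- `min_{k ∈ S} |v_k|`, for a nonempty finite index set `S`. -/
def minAbs {ι : Type*} (S : Finset ι) (v : ι → ℝ) : ℝ := ⨅ k : S, |v k|

/-- `pen` is a folded concave penalty with tuning parameter `lam` and constants `a1`, `a2`, `γ`;
`dpen` is its derivative on `(0, ∞)`, extended to `0` by its right limit. -/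
structure IsFoldedConcave (a1 a2 γ lam : ℝ) (pen dpen : ℝ → ℝ) : Prop where
  mono : MonotoneOn pen (Set.Ici 0)
  concave : ConcaveOn ℝ (Set.Ici 0) pen
  map_zero : pen 0 = 0
  hasDeriv : ∀ t, 0 < t → HasDerivAt pen (dpen t) t
  right_limit : Tendsto dpen (𝓝[>] 0) (𝓝 (dpen 0))
  deriv_zero : a1 * lam ≤ dpen 0
  deriv_near : ∀ t, 0 < t → t ≤ a2 * lam → a1 * lam ≤ dpen t
  deriv_far : ∀ t, γ * lam ≤ t → dpen t = 0

/-- The sparse covariance regression model: a `p`-dimensional random vector `y` with mean zero and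
covariance `∑_k β_k W_k`, where `W_0 = I_p`, `W_1, …, W_K` are symmetric matrices and `β` (the true
coefficient vector) has exactly `s + 1` nonzero entries. -/
structure SCRModel (Ω : Type*) [MeasurableSpace Ω] (μ : Measure Ω) where
  p : ℕ
  K : ℕ
  s : ℕ
  p_pos : 0 < p
  W : Fin (K + 1) → Matrix (Fin p) (Fin p) ℝ
  W_symm : ∀ k, (W k).IsSymm
  W_zero : W 0 = 1
  β : Fin (K + 1) → ℝ
  card_support : (Finset.univ.filter fun k => β k ≠ 0).card = s + 1
  y : Ω → Fin p → ℝ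
  measurable_y : Measurable y
  integrable_y : ∀ i, Integrable (fun ω => y ω i) μ
  mean_y : ∀ i, ∫ ω, y ω i ∂μ = 0
  integrable_yy : ∀ i j, Integrable (fun ω => y ω i * y ω j) μ
  cov_y : ∀ i j, ∫ ω, y ω i * y ω j ∂μ = (∑ k, β k • W k) i j

namespace SCRModel

variable {Ω : Type*} [MeasurableSpace Ω] {μ : Measure Ω} (M : SCRModel Ω μ)

/-- Coefficient vectors, indexed by `0, …, K`. -/
abbrev Coef : Type := Fin (M.K + 1) → ℝ

/-- The support of the true coefficient vector. -/
def S : Finset (Fin (M.K + 1)) := Finset.univ.filter fun k => M.β k ≠ 0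

/-- `Σ(b) = ∑_k b_k W_k`. -/
def cov (b : M.Coef) : Matrix (Fin M.p) (Fin M.p) ℝ := ∑ k, b k • M.W k

/-- The least squares loss `Q(b) = (2p)⁻¹ ‖v vᵀ - Σ(b)‖_F²` of the observation `v`. -/
def Q (v : Fin M.p → ℝ) (b : M.Coef) : ℝ :=
  1 / (2 * (M.p : ℝ)) * frobSq (Matrix.vecMulVec v v - M.cov b)

/-- The partial derivative of `Q` in the `k`-th coefficient. -/
def gradQ (v : Fin M.p → ℝ) (b : M.Coef) (k : Fin (M.K + 1)) : ℝ :=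
  deriv (fun t => M.Q v (Function.update b k t)) (b k)

/-- `b` is a Lasso estimator: a minimizer of `Q(b) + lam0 ‖b‖₁`. -/
def IsLasso (lam0 : ℝ) (v : Fin M.p → ℝ) (b : M.Coef) : Prop :=
  IsMinOn (fun b' : M.Coef => M.Q v b' + lam0 * ∑ k, |b' k|) Set.univ b

/-- `b` minimizes `Q` among the coefficient vectors that vanish off the true support. -/
def IsOracle (v : Fin M.p → ℝ) (b : M.Coef) : Prop :=
  b ∈ {b' : M.Coef | ∀ k, k ∉ M.S → b' k = 0} ∧
    IsMinOn (M.Q v) {b' : M.Coef | ∀ k, k ∉ M.S → b' k = 0} b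

/-- The oracle estimator (a choice of minimizer; the minimizer is unique as soon as the
Gram matrix of the `W_k`, `k ∈ S`, is invertible). -/
def oracle (v : Fin M.p → ℝ) : M.Coef := Classical.epsilon (M.IsOracle v)

/-- `b 0, b 1, b 2, …` is a run of the local linear approximation algorithm for a penalty with
derivative `dpen`, started at `init`: each iterate is a minimizer of the weighted `ℓ₁` problem
whose weights come from the previous iterate. -/
def IsLLA (dpen : ℝ → ℝ) (v : Fin M.p → ℝ) (init : M.Coef) (b : ℕ → M.Coef) : Prop :=
  b 0 = init ∧ ∀ m, IsMinOn
    (fun b' : M.Coef => M.Q v b' + ∑ k, dpen |b m k| * |b' k|) Set.univ (b (m + 1))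

/-- The algorithm started at `init` can be run, and in every run the first and second (hence
converged) iterates, and all later ones, are the vector `target`. -/
def LLAConvergesTo (dpen : ℝ → ℝ) (v : Fin M.p → ℝ) (init target : M.Coef) : Prop :=
  (∃ b, M.IsLLA dpen v init b) ∧
    ∀ b, M.IsLLA dpen v init b → ∀ m, 1 ≤ m → b m = target

/-- Minimal signal strength. -/
def MinSignal (γ lam : ℝ) : Prop := (γ + 1) * lam < minAbs M.S M.β

/-- `Σ_{W,S} = {tr(W_k W_l) : k, l ∈ S}`. -/
def gramS : Matrix M.S M.S ℝ := Matrix.of fun k l => (M.W k * M.W l).trace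

/-- Minimal eigenvalue condition. -/
def MinEigen (τmin : ℝ) : Prop := τmin ≤ lambdaMin ((M.p : ℝ)⁻¹ • M.gramS)

/-- `y = Σ₀^{1/2} Z` with `Z` having i.i.d. sub-Gaussian coordinates of mean zero and variance one,
and `λ_min(Σ₀) > σmin`. (A common finite fourth moment of the `Z_j` is automatic.) -/
def SubGaussian (c : ℝ≥0) (σmin : ℝ) : Prop :=
  (∃ Z : Ω → Fin M.p → ℝ, Measurable Z ∧
    (∀ᵐ ω ∂μ, M.y ω = (matSqrt (M.cov M.β)).mulVec (Z ω)) ∧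
    iIndepFun (fun j ω => Z ω j) μ ∧
    (∀ i j, IdentDistrib (fun ω => Z ω i) (fun ω => Z ω j) μ μ) ∧
    (∀ j, ∫ ω, Z ω j ∂μ = 0) ∧
    (∀ j, variance (fun ω => Z ω j) μ = 1) ∧
    (∀ j, HasSubgaussianMGF (fun ω => Z ω j) (c ^ 2) μ)) ∧
  σmin < lambdaMin (M.cov M.β)

/-- Bounded `ℓ₁`-norms. -/
def BoundedL1 (w σmax : ℝ) : Prop :=
  (∀ k, matOneNorm (M.W k) ≤ w) ∧ matOneNorm (matSqrt (M.cov M.β)) ≤ √σmax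

/-- Restricted eigenvalue condition over the cone `‖d_{Sᶜ}‖₁ ≤ 3 ‖d_S‖₁`. -/
def RestrictedEigen (κ : ℝ) : Prop :=
  ∀ d : M.Coef, ∑ k ∈ M.Sᶜ, |d k| ≤ 3 * ∑ k ∈ M.S, |d k| →
    κ * ∑ k, d k ^ 2 ≤ 1 / (M.p : ℝ) * frobSq (∑ k, d k • M.W k)

/-- `P(‖init - β‖_∞ > a0 lam)`; the norm of `Fin _ → ℝ` is the maximum norm. -/
def delta0 (init : Ω → M.Coef) (a0 lam : ℝ) : ℝ := μ.real {ω | a0 * lam < ‖init ω - M.β‖}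

/-- `P(max_{k ∉ S} |∂_k Q(oracle)| ≥ a1 lam)`; the event is empty if every index is in `S`. -/
def delta1 (a1 lam : ℝ) : ℝ :=
  μ.real {ω | ∃ k, k ∉ M.S ∧ a1 * lam ≤ |M.gradQ (M.y ω) (M.oracle (M.y ω)) k|}

/-- `P(min_{k ∈ S} |oracle_k| < γ lam)`. -/
def delta2 (γ lam : ℝ) : ℝ := μ.real {ω | minAbs M.S (M.oracle (M.y ω)) < γ * lam}

/-- The bound for `delta0`. -/
def bound0 (C1 C2 w σmax lam0 : ℝ) : ℝ :=
  2 * ((M.K : ℝ) + 1) * Real.exp (-min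
    (C1 * M.p * lam0 ^ 2 / (w ^ 2 * σmax ^ 2))
    (C2 * M.p * lam0 / (w * σmax)))

/-- The bound for `delta1`. -/
def bound1 (C3 C4 C5 C6 a1 w σmax τmin lam : ℝ) : ℝ :=
  2 * ((M.K : ℝ) - M.s) * Real.exp (-min
      (C3 * a1 ^ 2 * M.p * lam ^ 2 / (w ^ 2 * σmax ^ 2))
      (C4 * a1 * M.p * lam / (w * σmax)))
    + 2 * ((M.K : ℝ) - M.s) * ((M.s : ℝ) + 1) * Real.exp (-min
      (C5 * a1 ^ 2 * τmin ^ 2 * M.p * lam ^ 2 / (w ^ 6 * σmax ^ 2 * ((M.s : ℝ) + 1) ^ 2))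
      (C6 * a1 * τmin * M.p * lam / (w ^ 3 * σmax * ((M.s : ℝ) + 1))))

/-- The bound for `delta2`. -/
def bound2 (C7 C8 γ w σmax τmin lam : ℝ) : ℝ :=
  2 * ((M.s : ℝ) + 1) * Real.exp (-min
    (C7 * τmin ^ 2 * M.p * (minAbs M.S M.β - γ * lam) ^ 2
      / (w ^ 2 * σmax ^ 2 * ((M.s : ℝ) + 1)))
    (C8 * τmin * M.p * (minAbs M.S M.β - γ * lam)
      / (w * σmax * √((M.s : ℝ) + 1))))

end SCRModel

end

/-! ### Matrices -/

/-! The loss is a quadratic polynomial, so its second-order expansion `Q_eq` is exact, with gradient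
`score`. Under (C2) the quadratic part is positive definite on vectors supported on `S`, so the
oracle is the unique solution of the normal equations there and its score vanishes on `S`.

Two-step convergence is deterministic. If an iterate produces weights that vanish on `S` and
strictly exceed the oracle score off `S`, expanding around the oracle shows that it is the only
minimizer of the weighted problem (`MinEigen.isMinOn_weighted_iff`). Outside the three failure
events the initial vector produces such weights, because (C1) leaves room for an error of `min 1 a2
* lam`. So does the oracle itself, which is therefore a fixed point
(`MinEigen.llaConvergesTo_oracle`).

For the probability bounds, each failure event forces some score at the true `β` to be large. The
Lasso error is controlled by the basic inequality, the cone condition and (C5)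
(`IsLasso.norm_sub_le`). The oracle error is controlled by (C2) (`MinEigen.norm_oracle_sub_le`), and
it also gives the off-support score of the oracle. Up to sign, `p` times a score at `β` is the
centered quadratic form of `Z` with matrix `Σ₀^{1/2} W_k Σ₀^{1/2}`, whose column sums are at most `w
* σmax`.

Its tails come from a Hanson–Wright inequality (`measureReal_abs_centeredForm_ge_le`). Convexity
separates the diagonal from the off-diagonal part. The diagonal is a sum of independent centered
squares. The off-diagonal part is decoupled by averaging over subsets of coordinates: conditionally
on one block it is linear in the other, and the resulting squared norm is bounded by the Schur test.
Exponential moments of squares come from a Gaussian linearization.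

For the limit, (C5) applied to `β` itself bounds the signal (`minAbs_β_le`), hence also `lam0`. The
linear regimes of the exponents then dominate a multiple of `p * lam0 ^ 2 / (s + 1)`, as the
quadratic ones do. The sum of the failure probabilities is at most `8 (K + 1)²` times one
exponential (`delta_sum_le`), and the rate assumption absorbs the polynomial factor. -/

/-- Frobenius inner product. -/
noncomputable def frobInner {m n : Type*} [Fintype m] [Fintype n] (A B : Matrix m n ℝ) : ℝ :=
  ∑ i, ∑ j, A i j * B i j

section FrobInner

variable {m n : Type*} [Fintype m] [Fintype n]

lemma frobInner_self (A : Matrix m n ℝ) : frobInner A A = frobSq A := by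
  simp [frobInner, frobSq, sq]

lemma frobInner_comm (A B : Matrix m n ℝ) : frobInner A B = frobInner B A := by
  simp [frobInner, mul_comm]

lemma frobInner_add_left (A B C : Matrix m n ℝ) :
    frobInner (A + B) C = frobInner A C + frobInner B C := by
  simp [frobInner, add_mul, Finset.sum_add_distrib]

lemma frobInner_sub_left (A B C : Matrix m n ℝ) :
    frobInner (A - B) C = frobInner A C - frobInner B C := by
  simp [frobInner, sub_mul, Finset.sum_sub_distrib]

lemma frobInner_smul_left (r : ℝ) (A B : Matrix m n ℝ) :
    frobInner (r • A) B = r * frobInner A B := by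
  simp [frobInner, Finset.mul_sum, mul_assoc]

lemma frobInner_sum_smul_left {ι : Type*} (s : Finset ι) (r : ι → ℝ) (A : ι → Matrix m n ℝ)
    (B : Matrix m n ℝ) :
    frobInner (∑ k ∈ s, r k • A k) B = ∑ k ∈ s, r k * frobInner (A k) B := by
  classical
  induction s using Finset.induction_on with
  | empty => simp [frobInner]
  | insert a s ha ih =>
    rw [Finset.sum_insert ha, Finset.sum_insert ha, frobInner_add_left, frobInner_smul_left, ih]

lemma frobSq_nonneg (A : Matrix m n ℝ) : 0 ≤ frobSq A := by
  unfold frobSq; positivity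

lemma frobSq_sub (A B : Matrix m n ℝ) :
    frobSq (A - B) = frobSq A - 2 * frobInner A B + frobSq B := by
  simp only [frobSq, frobInner, Matrix.sub_apply, Finset.mul_sum, ← Finset.sum_sub_distrib,
    ← Finset.sum_add_distrib]
  refine Finset.sum_congr rfl fun i _ => Finset.sum_congr rfl fun j _ => ?_
  ring

lemma trace_mul_eq_frobInner (A B : Matrix n n ℝ) (hB : B.IsSymm) :
    (A * B).trace = frobInner A B := by
  simp only [Matrix.trace, Matrix.diag, Matrix.mul_apply, frobInner]
  refine Finset.sum_congr rfl fun i _ => Finset.sum_congr rfl fun j _ => ?_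
  rw [hB.apply]

end FrobInner

/-! ### The maximal column sum norm. -/

section MatOneNorm

variable {m n l : Type*} [Fintype m] [Fintype n] [Fintype l]

lemma sum_abs_col_le_matOneNorm (A : Matrix m n ℝ) (j : n) : ∑ i, |A i j| ≤ matOneNorm A :=
  le_ciSup (f := fun j => ∑ i, |A i j|) (Set.finite_range _).bddAbove j

lemma matOneNorm_nonneg (A : Matrix m n ℝ) : 0 ≤ matOneNorm A :=
  Real.iSup_nonneg fun _ => Finset.sum_nonneg fun _ _ => abs_nonneg _

lemma matOneNorm_mul_le (A : Matrix m n ℝ) (B : Matrix n l ℝ) :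
    matOneNorm (A * B) ≤ matOneNorm A * matOneNorm B := by
  refine Real.iSup_le (fun j => ?_) (mul_nonneg (matOneNorm_nonneg A) (matOneNorm_nonneg B))
  calc ∑ i, |(A * B) i j| ≤ ∑ i, ∑ k, |A i k| * |B k j| := by
        refine Finset.sum_le_sum fun i _ => ?_
        rw [Matrix.mul_apply]
        refine (Finset.abs_sum_le_sum_abs _ _).trans (le_of_eq ?_)
        simp [abs_mul]
    _ = ∑ k, (∑ i, |A i k|) * |B k j| := by
        rw [Finset.sum_comm]; simp [Finset.sum_mul]
    _ ≤ ∑ k, matOneNorm A * |B k j| := by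
        gcongr with k; exact sum_abs_col_le_matOneNorm A k
    _ ≤ matOneNorm A * matOneNorm B := by
        rw [← Finset.mul_sum]
        exact mul_le_mul_of_nonneg_left (sum_abs_col_le_matOneNorm B j) (matOneNorm_nonneg A)

lemma abs_apply_le_matOneNorm (A : Matrix m n ℝ) (i : m) (j : n) : |A i j| ≤ matOneNorm A :=
  (Finset.single_le_sum (f := fun i => |A i j|) (fun _ _ => abs_nonneg _)
    (Finset.mem_univ i)).trans (sum_abs_col_le_matOneNorm A j)

/-- Entries of one factor are bounded by its norm, columns of the other are summed. The point is a
bound linear in the dimension, which the normalization by `p` cancels. -/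
lemma abs_frobInner_le (A B : Matrix m n ℝ) :
    |frobInner A B| ≤ Fintype.card n * (matOneNorm A * matOneNorm B) := by
  calc |frobInner A B| ≤ ∑ i, ∑ j, |A i j| * |B i j| := by
        refine (Finset.abs_sum_le_sum_abs _ _).trans (Finset.sum_le_sum fun i _ => ?_)
        refine (Finset.abs_sum_le_sum_abs _ _).trans (le_of_eq ?_)
        simp [abs_mul]
    _ ≤ ∑ i, ∑ j, |A i j| * matOneNorm B := by
        gcongr; exact abs_apply_le_matOneNorm B _ _
    _ = ∑ j, (∑ i, |A i j|) * matOneNorm B := by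
        rw [Finset.sum_comm]; simp [Finset.sum_mul]
    _ ≤ ∑ _j : n, matOneNorm A * matOneNorm B := by
        gcongr with j
        · exact matOneNorm_nonneg B
        · exact sum_abs_col_le_matOneNorm A j
    _ = _ := by simp

/-- Schur test for a symmetric matrix. -/
lemma sum_mulVec_sq_le (A : Matrix n n ℝ) (hA : A.IsSymm) (x : n → ℝ) :
    ∑ j, (∑ i, A i j * x i) ^ 2 ≤ matOneNorm A ^ 2 * ∑ i, x i ^ 2 := by
  have h1 : ∀ j, (∑ i, A i j * x i) ^ 2 ≤ matOneNorm A * ∑ i, |A i j| * x i ^ 2 := by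
    intro j
    -- Cauchy–Schwarz with each `|A i j|` split as a product of square roots.
    have hcs := Finset.sum_mul_sq_le_sq_mul_sq Finset.univ
      (fun i => √|A i j|) (fun i => √|A i j| * |x i|)
    have habs : |∑ i, A i j * x i| ≤ ∑ i, √|A i j| * (√|A i j| * |x i|) := by
      refine (Finset.abs_sum_le_sum_abs _ _).trans (le_of_eq ?_)
      refine Finset.sum_congr rfl fun i _ => ?_
      rw [abs_mul, ← mul_assoc, Real.mul_self_sqrt (abs_nonneg _)]
    calc (∑ i, A i j * x i) ^ 2 = |∑ i, A i j * x i| ^ 2 := (sq_abs _).symm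
      _ ≤ _ := pow_le_pow_left₀ (abs_nonneg _) habs 2
      _ ≤ _ := hcs
      _ = (∑ i, |A i j|) * ∑ i, |A i j| * x i ^ 2 := by
          simp [mul_pow]
      _ ≤ _ := by
          gcongr
          exact sum_abs_col_le_matOneNorm A j
  calc _ ≤ ∑ j, matOneNorm A * ∑ i, |A i j| * x i ^ 2 := Finset.sum_le_sum fun j _ => h1 j
    _ = matOneNorm A * ∑ i, (∑ j, |A j i|) * x i ^ 2 := by
        rw [← Finset.mul_sum, Finset.sum_comm]
        congr 1
        refine Finset.sum_congr rfl fun i _ => ?_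
        rw [Finset.sum_mul]
        refine Finset.sum_congr rfl fun j _ => ?_
        rw [hA.apply]
    _ ≤ matOneNorm A * ∑ i, matOneNorm A * x i ^ 2 := by
        gcongr with i
        · exact matOneNorm_nonneg A
        · exact sum_abs_col_le_matOneNorm A i
    _ = _ := by rw [← Finset.mul_sum]; ring

lemma frobSq_le_matOneNorm_sq (A : Matrix m n ℝ) :
    frobSq A ≤ Fintype.card n * matOneNorm A ^ 2 := by
  rw [← frobInner_self, sq]
  exact (le_abs_self _).trans (abs_frobInner_le A A)

end MatOneNorm

/-! ### Least eigenvalue and matrix square root. -/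

section Spectral

variable {n : Type*} [Fintype n] [DecidableEq n]

lemma lambdaMin_le_of_mem_spectrum {A : Matrix n n ℝ} {x : ℝ} (hx : x ∈ spectrum ℝ A) :
    lambdaMin A ≤ x :=
  csInf_le (Matrix.finite_real_spectrum (A := A)).bddBelow hx

/-- Shifting by `lambdaMin A` moves the spectrum into the nonnegative reals, so the shifted matrix
is positive semidefinite. -/
lemma lambdaMin_mul_sum_sq_le {A : Matrix n n ℝ} (hA : A.IsSymm) (x : n → ℝ) :
    lambdaMin A * ∑ i, x i ^ 2 ≤ ∑ i, ∑ j, x i * A i j * x j := by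
  have hH : A.IsHermitian := by
    rw [Matrix.IsHermitian, Matrix.conjTranspose_eq_transpose_of_trivial]; exact hA
  have hps : (A - algebraMap ℝ (Matrix n n ℝ) (lambdaMin A)).PosSemidef := by
    rw [Matrix.posSemidef_iff_isHermitian_and_spectrum_nonneg]
    refine ⟨?_, ?_⟩
    · refine hH.sub ?_
      rw [Algebra.algebraMap_eq_smul_one, Matrix.IsHermitian]
      simp
    · intro z hz
      have hz' : z + lambdaMin A ∈ spectrum ℝ A := by
        have h2 := (spectrum.add_mem_add_iff (R := ℝ) (s := lambdaMin A) (r := z)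
          (a := A - algebraMap ℝ (Matrix n n ℝ) (lambdaMin A))).2 hz
        rwa [add_sub_cancel] at h2
      have := lambdaMin_le_of_mem_spectrum hz'
      show 0 ≤ z
      linarith
  have h := hps.dotProduct_mulVec_nonneg x
  simp only [star_trivial, Matrix.sub_mulVec, dotProduct_sub, Algebra.algebraMap_eq_smul_one,
    Matrix.smul_mulVec, Matrix.one_mulVec, dotProduct_smul, smul_eq_mul] at h
  have e1 : x ⬝ᵥ x = ∑ i, x i ^ 2 := by simp [dotProduct, sq]
  have e2 : x ⬝ᵥ A.mulVec x = ∑ i, ∑ j, x i * A i j * x j := by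
    simp [dotProduct, Matrix.mulVec, Finset.mul_sum, mul_assoc]
  rw [e1, e2] at h
  linarith

lemma matSqrt_isSymm (A : Matrix n n ℝ) : (matSqrt A).IsSymm := by
  have : IsSelfAdjoint (matSqrt A) := cfc_predicate _ _
  have h := this.star_eq
  rwa [Matrix.star_eq_conjTranspose, Matrix.conjTranspose_eq_transpose_of_trivial] at h

lemma matSqrt_mul_self {A : Matrix n n ℝ} (hA : A.IsSymm) (h0 : 0 ≤ lambdaMin A) :
    matSqrt A * matSqrt A = A := by
  have hH : IsSelfAdjoint A := by
    rw [IsSelfAdjoint, Matrix.star_eq_conjTranspose, Matrix.conjTranspose_eq_transpose_of_trivial]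
    exact hA
  have hfin := Matrix.finite_real_spectrum (A := A)
  -- On a finite spectrum every function is continuous, so the functional calculus is multiplicative
  -- without further conditions.
  rw [matSqrt, ← cfc_mul Real.sqrt Real.sqrt A (hfin.continuousOn _) (hfin.continuousOn _)]
  conv_rhs => rw [← cfc_id ℝ A hH]
  refine cfc_congr fun x hx => ?_
  exact Real.mul_self_sqrt (h0.trans (lambdaMin_le_of_mem_spectrum hx))

end Spectral

/-! ### The least squares loss -/

namespace SCRModel

variable {Ω : Type*} [MeasurableSpace Ω] {μ : Measure Ω} (M : SCRModel Ω μ)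

lemma p_pos_real : (0 : ℝ) < M.p := Nat.cast_pos.2 M.p_pos

lemma mem_S {k : Fin (M.K + 1)} : k ∈ M.S ↔ M.β k ≠ 0 := by simp [S]

lemma card_S : M.S.card = M.s + 1 := M.card_support

lemma S_nonempty : M.S.Nonempty := by
  rw [← Finset.card_pos, card_S]; omega

lemma s_le_K : M.s ≤ M.K := by
  have := Finset.card_le_univ M.S
  rw [card_S, Fintype.card_fin] at this
  omega

lemma cov_add (b d : M.Coef) : M.cov (b + d) = M.cov b + M.cov d := by
  simp [cov, add_smul, Finset.sum_add_distrib]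

lemma cov_isSymm (b : M.Coef) : (M.cov b).IsSymm := by
  unfold cov
  rw [Matrix.IsSymm, Matrix.transpose_sum]
  refine Finset.sum_congr rfl fun k _ => ?_
  rw [Matrix.transpose_smul, M.W_symm k]

/-- Closed form of the partial derivatives of `Q`. -/
noncomputable def score (v : Fin M.p → ℝ) (b : M.Coef) (k : Fin (M.K + 1)) : ℝ :=
  1 / (M.p : ℝ) * (frobInner (M.cov b) (M.W k) - frobInner (Matrix.vecMulVec v v) (M.W k))

lemma frobInner_cov (b : M.Coef) (A : Matrix (Fin M.p) (Fin M.p) ℝ) :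
    frobInner (M.cov b) A = ∑ k, b k * frobInner (M.W k) A :=
  frobInner_sum_smul_left _ _ _ _

/-- The exact second-order Taylor expansion of a quadratic polynomial; all optimality arguments
start from it. -/
lemma Q_add (v : Fin M.p → ℝ) (b d : M.Coef) :
    M.Q v (b + d) = M.Q v b + ∑ k, d k * M.score v b k
      + 1 / (2 * (M.p : ℝ)) * frobSq (M.cov d) := by
  have hp := M.p_pos_real
  have h : ∑ k, d k * M.score v b k
      = 1 / (M.p : ℝ) * (frobInner (M.cov b) (M.cov d)
        - frobInner (Matrix.vecMulVec v v) (M.cov d)) := by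
    rw [frobInner_comm _ (M.cov d), frobInner_comm _ (M.cov d), frobInner_cov, frobInner_cov,
      ← Finset.sum_sub_distrib, Finset.mul_sum]
    refine Finset.sum_congr rfl fun k _ => ?_
    rw [score, frobInner_comm (M.cov b), frobInner_comm (Matrix.vecMulVec v v)]
    ring
  rw [h, Q, Q, cov_add, ← sub_sub, frobSq_sub (Matrix.vecMulVec v v - M.cov b),
    frobInner_sub_left]
  field_simp
  ring

lemma Q_eq (v : Fin M.p → ℝ) (b b' : M.Coef) :
    M.Q v b' = M.Q v b + ∑ k, (b' k - b k) * M.score v b k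
      + 1 / (2 * (M.p : ℝ)) * frobSq (M.cov (b' - b)) := by
  have := M.Q_add v b (b' - b)
  rw [add_sub_cancel] at this
  simpa using this

lemma score_add (v : Fin M.p → ℝ) (b d : M.Coef) (k : Fin (M.K + 1)) :
    M.score v (b + d) k = M.score v b k + 1 / (M.p : ℝ) * frobInner (M.cov d) (M.W k) := by
  simp only [score, cov_add, frobInner_add_left]; ring

lemma cov_single (k : Fin (M.K + 1)) (t : ℝ) : M.cov (Pi.single k t) = t • M.W k := by
  unfold cov
  rw [Finset.sum_eq_single k]
  · simp
  · intro j _ hj; simp [hj]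
  · simp

lemma gradQ_eq_score (v : Fin M.p → ℝ) (b : M.Coef) (k : Fin (M.K + 1)) :
    M.gradQ v b k = M.score v b k := by
  have hf : (fun t => M.Q v (Function.update b k t)) = fun t =>
      M.Q v b + (t - b k) * M.score v b k
        + 1 / (2 * (M.p : ℝ)) * ((t - b k) ^ 2 * frobSq (M.W k)) := by
    funext t
    have hu : Function.update b k t = b + Pi.single k (t - b k) := by
      ext j
      by_cases hj : j = k
      · subst hj; simp
      · simp [hj]
    rw [hu, Q_add, cov_single]
    congr 2
    · rw [Finset.sum_eq_single k]
      · simp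
      · intro j _ hj; simp [hj]
      · simp
    · rw [← frobInner_self, frobInner_smul_left, frobInner_comm, frobInner_smul_left,
        frobInner_self]
      ring
  rw [gradQ, hf]
  have h1 : HasDerivAt (fun t : ℝ => t - b k) 1 (b k) := (hasDerivAt_id _).sub_const _
  have h2 := ((h1.mul_const (M.score v b k)).const_add (M.Q v b)).add
    (((h1.pow 2).mul_const (frobSq (M.W k))).const_mul (1 / (2 * (M.p : ℝ))))
  refine (h2.deriv.trans ?_)
  simp

/-! ### The oracle estimator -/

/-- Coefficient vectors supported on the true support. -/
def supported : Set M.Coef := {b | ∀ k, k ∉ M.S → b k = 0}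

lemma sum_eq_sum_S {b : M.Coef} (hb : b ∈ M.supported) (f : Fin (M.K + 1) → ℝ → ℝ)
    (hf : ∀ k, f k 0 = 0) : ∑ k, f k (b k) = ∑ k ∈ M.S, f k (b k) := by
  symm
  refine Finset.sum_subset (Finset.subset_univ _) fun k _ hk => ?_
  rw [hb k hk, hf]

lemma β_supported : M.β ∈ M.supported := fun k hk => by
  simpa [mem_S] using hk

lemma gramS_isSymm : M.gramS.IsSymm := by
  ext k l
  simp [gramS, Matrix.trace_mul_comm (M.W k)]

lemma gramS_apply (k l : M.S) : M.gramS k l = frobInner (M.W k) (M.W l) := by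
  simp [gramS, trace_mul_eq_frobInner _ _ (M.W_symm l)]

lemma frobSq_cov_eq {d : M.Coef} (hd : d ∈ M.supported) :
    frobSq (M.cov d) = ∑ k : M.S, ∑ l : M.S, d k * M.gramS k l * d l := by
  rw [← frobInner_self, frobInner_cov,
    M.sum_eq_sum_S hd (fun k t => t * frobInner (M.W k) (M.cov d)) (by simp), ← Finset.sum_coe_sort]
  refine Finset.sum_congr rfl fun k _ => ?_
  rw [frobInner_comm, frobInner_cov,
    M.sum_eq_sum_S hd (fun l t => t * frobInner (M.W l) (M.W k)) (by simp), ← Finset.sum_coe_sort,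
    Finset.mul_sum]
  refine Finset.sum_congr rfl fun l _ => ?_
  rw [gramS_apply, frobInner_comm]; ring

variable {M} in
-- Condition (C2) in the form in which it is used: strong convexity of the loss along supported
-- directions.
lemma MinEigen.mul_sum_sq_le {τ : ℝ} (h : M.MinEigen τ) {d : M.Coef} (hd : d ∈ M.supported) :
    τ * ∑ k, d k ^ 2 ≤ 1 / (M.p : ℝ) * frobSq (M.cov d) := by
  have h1 : ((M.p : ℝ)⁻¹ • M.gramS).IsSymm := by
    rw [Matrix.IsSymm, Matrix.transpose_smul, M.gramS_isSymm]
  have h2 := lambdaMin_mul_sum_sq_le h1 (fun k : M.S => d k)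
  rw [M.sum_eq_sum_S hd (fun _ t => t ^ 2) (by simp), ← Finset.sum_coe_sort]
  calc _ ≤ lambdaMin ((M.p : ℝ)⁻¹ • M.gramS) * ∑ k : M.S, d k ^ 2 :=
        mul_le_mul_of_nonneg_right h (by positivity)
    _ ≤ _ := h2
    _ = _ := by
        rw [M.frobSq_cov_eq hd, Finset.mul_sum]
        refine Finset.sum_congr rfl fun k _ => ?_
        rw [Finset.mul_sum]
        refine Finset.sum_congr rfl fun l _ => ?_
        simp [Matrix.smul_apply]; ring

variable {M} in
lemma MinEigen.eq_zero_of_frobSq_cov_le {τ : ℝ} (h : M.MinEigen τ) (hτ : 0 < τ) {d : M.Coef}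
    (hd : d ∈ M.supported) (h0 : frobSq (M.cov d) ≤ 0) : d = 0 := by
  have h1 := h.mul_sum_sq_le hd
  have hp := M.p_pos_real
  have h2 : 1 / (M.p : ℝ) * frobSq (M.cov d) ≤ 0 :=
    mul_nonpos_of_nonneg_of_nonpos (by positivity) h0
  have h3 : ∑ k, d k ^ 2 ≤ 0 := by
    by_contra hc
    push Not at hc
    nlinarith [mul_pos hτ hc]
  have h4 := (Finset.sum_eq_zero_iff_of_nonneg (fun k _ => sq_nonneg (d k))).1
    (le_antisymm h3 (Finset.sum_nonneg fun k _ => sq_nonneg (d k)))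
  funext k
  simpa using h4 k (Finset.mem_univ k)

variable {M} in
-- A kernel vector, extended by zero off `S`, would be a supported direction along which the
-- quadratic part of the loss vanishes.
lemma MinEigen.isUnit_det {τ : ℝ} (h : M.MinEigen τ) (hτ : 0 < τ) : IsUnit M.gramS.det := by
  rw [isUnit_iff_ne_zero]
  intro hdet
  obtain ⟨x, hx, hx0⟩ := Matrix.exists_mulVec_eq_zero_iff.2 hdet
  let d : M.Coef := fun k => if hk : k ∈ M.S then x ⟨k, hk⟩ else 0
  have hd : d ∈ M.supported := fun k hk => by simp [d, hk]
  have hdx : ∀ k : M.S, d k = x k := fun k => by simp [d]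
  refine hx ?_
  have h0 : d = 0 := by
    refine h.eq_zero_of_frobSq_cov_le hτ hd (le_of_eq ?_)
    rw [M.frobSq_cov_eq hd]
    refine Finset.sum_eq_zero fun k _ => ?_
    have := congrFun hx0 k
    simp only [Matrix.mulVec, dotProduct, Pi.zero_apply] at this
    simp only [hdx, mul_assoc, ← Finset.mul_sum, this, mul_zero]
  funext k
  rw [← hdx, h0]; rfl

/-- The normal equations solved on the true support. -/
noncomputable def oracleFormula (v : Fin M.p → ℝ) : M.Coef := fun k =>
  if hk : k ∈ M.S then
    (M.gramS⁻¹.mulVec fun l : M.S => frobInner (Matrix.vecMulVec v v) (M.W l)) ⟨k, hk⟩ else 0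

lemma oracleFormula_supported (v : Fin M.p → ℝ) : M.oracleFormula v ∈ M.supported :=
  fun k hk => by simp [oracleFormula, hk]

variable {M} in
lemma MinEigen.score_oracleFormula {τ : ℝ} (h : M.MinEigen τ) (hτ : 0 < τ) (v : Fin M.p → ℝ)
    {k : Fin (M.K + 1)} (hk : k ∈ M.S) : M.score v (M.oracleFormula v) k = 0 := by
  have h1 : M.gramS.mulVec (fun l : M.S => M.oracleFormula v l)
      = fun l : M.S => frobInner (Matrix.vecMulVec v v) (M.W l) := by
    have : (fun l : M.S => M.oracleFormula v l)
        = M.gramS⁻¹.mulVec fun l : M.S => frobInner (Matrix.vecMulVec v v) (M.W l) := by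
      funext l; simp [oracleFormula]
    rw [this, Matrix.mulVec_mulVec, Matrix.mul_nonsing_inv _ (h.isUnit_det hτ), Matrix.one_mulVec]
  have h2 := congrFun h1 ⟨k, hk⟩
  rw [score, ← h2, frobInner_cov, M.sum_eq_sum_S (M.oracleFormula_supported v)
    (fun l t => t * frobInner (M.W l) (M.W k)) (by simp), ← Finset.sum_coe_sort]
  simp only [Matrix.mulVec, dotProduct, gramS_apply]
  rw [sub_eq_zero.2, mul_zero]
  refine Finset.sum_congr rfl fun l _ => ?_
  rw [frobInner_comm, mul_comm]

variable {M} in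
-- Pythagoras: in the expansion around the solution of the normal equations, the linear term dies on
-- `S` because the score does, and off `S` because both vectors are zero.
lemma MinEigen.Q_oracleFormula_add {τ : ℝ} (h : M.MinEigen τ) (hτ : 0 < τ) (v : Fin M.p → ℝ)
    {b : M.Coef} (hb : b ∈ M.supported) :
    M.Q v b = M.Q v (M.oracleFormula v)
      + 1 / (2 * (M.p : ℝ)) * frobSq (M.cov (b - M.oracleFormula v)) := by
  rw [M.Q_eq v (M.oracleFormula v) b, Finset.sum_eq_zero, add_zero]
  intro k _
  by_cases hk : k ∈ M.S
  · rw [h.score_oracleFormula hτ v hk, mul_zero]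
  · rw [hb k hk, M.oracleFormula_supported v k hk]; simp

lemma supported_sub {b b' : M.Coef} (hb : b ∈ M.supported) (hb' : b' ∈ M.supported) :
    b - b' ∈ M.supported := fun k hk => by simp [hb k hk, hb' k hk]

variable {M} in
-- By Pythagoras and strong convexity the constrained minimizer is unique, so the choice in `oracle`
-- is no choice. The closed form also makes the oracle measurable in the data.
lemma MinEigen.oracle_eq {τ : ℝ} (h : M.MinEigen τ) (hτ : 0 < τ) (v : Fin M.p → ℝ) :
    M.oracle v = M.oracleFormula v := by
  have hp := M.p_pos_real
  have hor : M.IsOracle v (M.oracleFormula v) := by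
    refine ⟨M.oracleFormula_supported v, fun b hb => ?_⟩
    show M.Q v _ ≤ M.Q v b
    rw [h.Q_oracleFormula_add hτ v hb]
    have := frobSq_nonneg (M.cov (b - M.oracleFormula v))
    have : 0 ≤ 1 / (2 * (M.p : ℝ)) * frobSq (M.cov (b - M.oracleFormula v)) := by positivity
    linarith
  have hor' : M.IsOracle v (M.oracle v) := Classical.epsilon_spec ⟨_, hor⟩
  have h1 : M.Q v (M.oracle v) ≤ M.Q v (M.oracleFormula v) := hor'.2 hor.1
  rw [h.Q_oracleFormula_add hτ v hor'.1] at h1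
  have h2 := h.eq_zero_of_frobSq_cov_le hτ (M.supported_sub hor'.1 hor.1) (by
    by_contra hc
    push Not at hc
    have : 0 < 1 / (2 * (M.p : ℝ)) * frobSq (M.cov (M.oracle v - M.oracleFormula v)) := by
      positivity
    linarith)
  exact sub_eq_zero.1 h2

variable {M} in
lemma MinEigen.oracle_supported {τ : ℝ} (h : M.MinEigen τ) (hτ : 0 < τ) (v : Fin M.p → ℝ) :
    M.oracle v ∈ M.supported := by
  rw [h.oracle_eq hτ]; exact M.oracleFormula_supported v

variable {M} in
lemma MinEigen.score_oracle {τ : ℝ} (h : M.MinEigen τ) (hτ : 0 < τ) (v : Fin M.p → ℝ)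
    {k : Fin (M.K + 1)} (hk : k ∈ M.S) : M.score v (M.oracle v) k = 0 := by
  rw [h.oracle_eq hτ]; exact h.score_oracleFormula hτ v hk

lemma continuous_oracleFormula : Continuous M.oracleFormula := by
  refine continuous_pi fun k => ?_
  unfold oracleFormula
  split_ifs with hk
  · simp only [Matrix.mulVec, dotProduct, frobInner, Matrix.vecMulVec_apply]
    fun_prop
  · exact continuous_const

lemma continuous_score : Continuous fun x : (Fin M.p → ℝ) × M.Coef => M.score x.1 x.2 := by
  refine continuous_pi fun k => ?_
  simp only [score, frobInner_cov]
  simp only [frobInner, Matrix.vecMulVec_apply]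
  fun_prop

variable {M} in
lemma MinEigen.measurable_oracle {τ : ℝ} (h : M.MinEigen τ) (hτ : 0 < τ) :
    Measurable fun ω => M.oracle (M.y ω) := by
  simp_rw [h.oracle_eq hτ]
  exact M.continuous_oracleFormula.measurable.comp M.measurable_y

/-- The estimation error of the oracle in terms of the score at the truth. -/
lemma MinEigen.norm_oracle_sub_le {M : SCRModel Ω μ} {τ : ℝ} (h : M.MinEigen τ) (hτ : 0 < τ)
    (v : Fin M.p → ℝ) {t : ℝ} (ht : 0 ≤ t) (hs : ∀ k ∈ M.S, |M.score v M.β k| ≤ t) :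
    √(∑ k, (M.oracle v k - M.β k) ^ 2) ≤ √((M.s : ℝ) + 1) * t / τ := by
  set d : M.Coef := M.oracle v - M.β with hd
  have hds : d ∈ M.supported := M.supported_sub (h.oracle_supported hτ v) M.β_supported
  -- The oracle score is zero on `S`, so the score at the truth equals minus the linear response to
  -- `d`; pairing with `d` gives the quadratic form.
  have h1 : 1 / (M.p : ℝ) * frobSq (M.cov d) = - ∑ k ∈ M.S, d k * M.score v M.β k := by
    rw [← frobInner_self, frobInner_cov,
      M.sum_eq_sum_S hds (fun k t => t * frobInner (M.W k) (M.cov d)) (by simp), Finset.mul_sum,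
      ← Finset.sum_neg_distrib]
    refine Finset.sum_congr rfl fun k hk => ?_
    have h2 := M.score_add v M.β d k
    rw [hd, add_sub_cancel, h.score_oracle hτ v hk, ← hd, frobInner_comm] at h2
    linear_combination d k * (-h2)
  have h3 := h.mul_sum_sq_le hds
  set N := √(∑ k, d k ^ 2) with hN
  have hN0 : 0 ≤ N := Real.sqrt_nonneg _
  have hN2 : N ^ 2 = ∑ k, d k ^ 2 := Real.sq_sqrt (Finset.sum_nonneg fun _ _ => sq_nonneg _)
  have h4 : - ∑ k ∈ M.S, d k * M.score v M.β k ≤ N * (√((M.s : ℝ) + 1) * t) := by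
    have hcs := Finset.sum_mul_sq_le_sq_mul_sq M.S d (M.score v M.β)
    have hS : ∑ k ∈ M.S, d k ^ 2 = N ^ 2 := by
      rw [hN2, M.sum_eq_sum_S hds (fun _ t => t ^ 2) (by simp)]
    have hg : ∑ k ∈ M.S, M.score v M.β k ^ 2 ≤ ((M.s : ℝ) + 1) * t ^ 2 := by
      calc _ ≤ ∑ _k ∈ M.S, t ^ 2 := Finset.sum_le_sum fun k hk => by
              rw [← sq_abs]; exact pow_le_pow_left₀ (abs_nonneg _) (hs k hk) 2
        _ = _ := by simp [card_S]
    have hs1 : √((M.s : ℝ) + 1) ^ 2 = (M.s : ℝ) + 1 := Real.sq_sqrt (by positivity)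
    refine (neg_le_abs _).trans (abs_le_of_sq_le_sq ?_ (by positivity))
    calc _ ≤ _ := hcs
      _ ≤ N ^ 2 * (((M.s : ℝ) + 1) * t ^ 2) := by rw [hS]; gcongr
      _ = _ := by rw [mul_pow, mul_pow, hs1]
  change N ≤ _
  rw [le_div_iff₀ hτ]
  rw [← hN2, h1] at h3
  rcases hN0.eq_or_lt with h0 | h0
  · rw [← h0]; simp; positivity
  · have : N * (N * τ) ≤ N * (√((M.s : ℝ) + 1) * t) := by nlinarith
    exact le_of_mul_le_mul_left this h0

lemma abs_le_sqrt_sum_sq {ι : Type*} [Fintype ι] (d : ι → ℝ) (k : ι) : |d k| ≤ √(∑ k, d k ^ 2) := by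
  refine Real.abs_le_sqrt ?_
  exact Finset.single_le_sum (f := fun k => d k ^ 2) (fun _ _ => sq_nonneg _) (Finset.mem_univ k)

/-! ### Two-step convergence -/

lemma minAbs_le {ι : Type*} {S : Finset ι} (v : ι → ℝ) {k : ι} (hk : k ∈ S) : minAbs S v ≤ |v k| :=
  ciInf_le (f := fun k : S => |v k|) (Set.finite_range _).bddBelow ⟨k, hk⟩

lemma exists_minAbs_eq {ι : Type*} {S : Finset ι} (hS : S.Nonempty) (v : ι → ℝ) :
    ∃ k ∈ S, |v k| = minAbs S v := by
  have : Nonempty S := hS.to_subtype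
  obtain ⟨k, hk⟩ := exists_eq_ciInf_of_finite (f := fun k : S => |v k|)
  exact ⟨k, k.2, hk⟩

/-- A weighted `ℓ₁` problem whose weights vanish on the support and dominate the score off the
support has the oracle as its unique solution. -/
lemma MinEigen.isMinOn_weighted_iff {M : SCRModel Ω μ} {τ : ℝ} (h : M.MinEigen τ) (hτ : 0 < τ)
    (v : Fin M.p → ℝ) (wt : Fin (M.K + 1) → ℝ) (hS : ∀ k ∈ M.S, wt k = 0)
    (hSc : ∀ k, k ∉ M.S → |M.score v (M.oracle v) k| < wt k) (b : M.Coef) :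
    IsMinOn (fun b' : M.Coef => M.Q v b' + ∑ k, wt k * |b' k|) Set.univ b ↔ b = M.oracle v := by
  have hp := M.p_pos_real
  have hsup := h.oracle_supported hτ v
  have hzero : ∑ k, wt k * |M.oracle v k| = 0 := by
    refine Finset.sum_eq_zero fun k _ => ?_
    by_cases hk : k ∈ M.S
    · rw [hS k hk, zero_mul]
    · rw [hsup k hk]; simp
  -- Coordinatewise subgradient inequality: both terms vanish on `S`, and off `S` the weight
  -- outweighs the score.
  have hterm : ∀ (b' : M.Coef) k,
      0 ≤ (b' k - M.oracle v k) * M.score v (M.oracle v) k + wt k * |b' k| := by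
    intro b' k
    by_cases hk : k ∈ M.S
    · rw [h.score_oracle hτ v hk, hS k hk]; simp
    · rw [hsup k hk, sub_zero]
      have h1 := neg_abs_le (b' k * M.score v (M.oracle v) k)
      rw [abs_mul] at h1
      nlinarith [hSc k hk, abs_nonneg (b' k)]
  have key : ∀ b' : M.Coef, M.Q v b' + ∑ k, wt k * |b' k| = M.Q v (M.oracle v)
      + ∑ k, ((b' k - M.oracle v k) * M.score v (M.oracle v) k + wt k * |b' k|)
      + 1 / (2 * (M.p : ℝ)) * frobSq (M.cov (b' - M.oracle v)) := by
    intro b'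
    rw [M.Q_eq v (M.oracle v) b', Finset.sum_add_distrib]; ring
  have hfn : ∀ b' : M.Coef, 0 ≤ 1 / (2 * (M.p : ℝ)) * frobSq (M.cov (b' - M.oracle v)) := by
    intro b'
    have := frobSq_nonneg (M.cov (b' - M.oracle v))
    positivity
  constructor
  · intro hb
    have h1 : M.Q v b + ∑ k, wt k * |b k| ≤ M.Q v (M.oracle v) + ∑ k, wt k * |M.oracle v k| :=
      hb (Set.mem_univ _)
    rw [hzero, key b] at h1
    have h2 : 0 ≤ ∑ k, ((b k - M.oracle v k) * M.score v (M.oracle v) k + wt k * |b k|) :=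
      Finset.sum_nonneg fun k _ => hterm b k
    have h3 := hfn b
    have h4 : ∑ k, ((b k - M.oracle v k) * M.score v (M.oracle v) k + wt k * |b k|) = 0 := by
      linarith
    have h5 := (Finset.sum_eq_zero_iff_of_nonneg (fun k _ => hterm b k)).1 h4
    -- Strict domination is needed here: equality in a coordinate off `S` forces that coordinate to
    -- be zero.
    have hbs : b ∈ M.supported := by
      intro k hk
      have h6 := h5 k (Finset.mem_univ k)
      rw [hsup k hk, sub_zero] at h6
      have h7 := neg_abs_le (b k * M.score v (M.oracle v) k)
      rw [abs_mul] at h7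
      by_contra hne
      nlinarith [hSc k hk, abs_pos.2 hne]
    refine sub_eq_zero.1 (h.eq_zero_of_frobSq_cov_le hτ (M.supported_sub hbs hsup) ?_)
    by_contra hc
    push Not at hc
    have : 0 < 1 / (2 * (M.p : ℝ)) * frobSq (M.cov (b - M.oracle v)) := by positivity
    linarith
  · rintro rfl b' -
    show M.Q v _ + _ ≤ M.Q v b' + _
    rw [hzero, key b']
    have h2 : 0 ≤ ∑ k, ((b' k - M.oracle v k) * M.score v (M.oracle v) k + wt k * |b' k|) :=
      Finset.sum_nonneg fun k _ => hterm b' k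
    linarith [hfn b']

/-- Both the initial vector and the oracle yield weights that vanish on `S` and dominate off it. In
`min 1 a2`, the `1` keeps the initial entries on `S` beyond `γ * lam`, where the derivative is zero;
the `a2` keeps those off `S` where it is at least `a1 * lam`. -/
lemma MinEigen.llaConvergesTo_oracle {M : SCRModel Ω μ} {τ a1 a2 γ lam : ℝ} {pen dpen : ℝ → ℝ}
    (h : M.MinEigen τ) (hτ : 0 < τ) (hlam : 0 ≤ lam)
    (hpen : IsFoldedConcave a1 a2 γ lam pen dpen) (hsig : M.MinSignal γ lam)
    (v : Fin M.p → ℝ) (init : M.Coef) (hinit : ‖init - M.β‖ ≤ min 1 a2 * lam)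
    (hscore : ∀ k, k ∉ M.S → |M.score v (M.oracle v) k| < a1 * lam)
    (hmin : ∀ k ∈ M.S, γ * lam ≤ |M.oracle v k|) :
    M.LLAConvergesTo dpen v init (M.oracle v) := by
  have hsup := h.oracle_supported hτ v
  have near : ∀ k, |init k - M.β k| ≤ min 1 a2 * lam := fun k =>
    (norm_le_pi_norm (init - M.β) k).trans hinit
  have w0 : ∀ k ∈ M.S, dpen |init k| = 0 := by
    intro k hk
    refine hpen.deriv_far _ ?_
    have h1 : (γ + 1) * lam < |M.β k| := lt_of_lt_of_le hsig (minAbs_le _ hk)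
    have h2 := near k
    have h3 : |M.β k| ≤ |init k| + |init k - M.β k| := by
      have := abs_sub_abs_le_abs_sub (M.β k) (init k)
      rw [abs_sub_comm (M.β k)] at this
      linarith
    have h4 : min 1 a2 * lam ≤ 1 * lam := mul_le_mul_of_nonneg_right (min_le_left _ _) hlam
    linarith
  have w0' : ∀ k, k ∉ M.S → |M.score v (M.oracle v) k| < dpen |init k| := by
    intro k hk
    refine (hscore k hk).trans_le ?_
    have h2 := near k
    rw [M.β_supported k hk, sub_zero] at h2
    have h4 : min 1 a2 * lam ≤ a2 * lam := mul_le_mul_of_nonneg_right (min_le_right _ _) hlam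
    -- The lower bound near the origin covers only positive arguments; an entry equal to zero uses
    -- the right limit.
    rcases (abs_nonneg (init k)).eq_or_lt with h0 | h0
    · rw [← h0]; exact hpen.deriv_zero
    · exact hpen.deriv_near _ h0 (h2.trans h4)
  have w1 : ∀ k ∈ M.S, dpen |M.oracle v k| = 0 := fun k hk => hpen.deriv_far _ (hmin k hk)
  have w1' : ∀ k, k ∉ M.S → |M.score v (M.oracle v) k| < dpen |M.oracle v k| := by
    intro k hk
    rw [hsup k hk, abs_zero]
    exact (hscore k hk).trans_le hpen.deriv_zero
  have i0 := h.isMinOn_weighted_iff hτ v _ w0 w0'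
  have i1 := h.isMinOn_weighted_iff hτ v _ w1 w1'
  refine ⟨⟨fun m => if m = 0 then init else M.oracle v, by simp, fun m => ?_⟩, ?_⟩
  · rcases m with _ | m
    · simpa using (i0 (M.oracle v)).2 rfl
    · simpa using (i1 (M.oracle v)).2 rfl
  · rintro b ⟨hb0, hb⟩ m hm
    induction m, hm using Nat.le_induction with
    | base =>
      have := hb 0
      rw [hb0] at this
      exact (i0 _).1 this
    | succ m _ ih =>
      have := hb m
      rw [ih] at this
      exact (i1 _).1 this

lemma MinEigen.measurableSet_large_score {M : SCRModel Ω μ} {τ : ℝ} (h : M.MinEigen τ)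
    (hτ : 0 < τ) (x : ℝ) : MeasurableSet
      {ω | ∃ k, k ∉ M.S ∧ x ≤ |M.gradQ (M.y ω) (M.oracle (M.y ω)) k|} := by
  have hc : ∀ k, Continuous fun v => |M.score v (M.oracle v) k| := by
    intro k
    simp_rw [h.oracle_eq hτ]
    exact continuous_abs.comp ((continuous_apply k).comp
      (M.continuous_score.comp (continuous_id.prodMk M.continuous_oracleFormula)))
  have hs : ∀ k, Measurable fun ω => |M.score (M.y ω) (M.oracle (M.y ω)) k| := fun k =>
    (hc k).measurable.comp M.measurable_y
  simp only [gradQ_eq_score, Set.ofPred_exists, Set.ofPred_and]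
  exact MeasurableSet.iUnion fun k => (MeasurableSet.const _).inter
    (measurableSet_le measurable_const (hs k))

lemma MinEigen.measurableSet_small_oracle {M : SCRModel Ω μ} {τ : ℝ} (h : M.MinEigen τ)
    (hτ : 0 < τ) (x : ℝ) : MeasurableSet {ω | minAbs M.S (M.oracle (M.y ω)) < x} := by
  have mo := h.measurable_oracle hτ
  have : Measurable fun ω => minAbs M.S (M.oracle (M.y ω)) := by
    unfold minAbs
    exact Measurable.iInf fun k =>
      continuous_abs.measurable.comp (measurable_pi_iff.1 mo (k : Fin (M.K + 1)))
  exact measurableSet_lt this measurable_const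

lemma one_sub_le_measureReal_compl_union [IsProbabilityMeasure μ] {E₀ E₁ E₂ : Set Ω}
    (h₀ : MeasurableSet E₀) (h₁ : MeasurableSet E₁) (h₂ : MeasurableSet E₂) :
    1 - μ.real E₀ - μ.real E₁ - μ.real E₂ ≤ μ.real (E₀ ∪ E₁ ∪ E₂)ᶜ := by
  rw [probReal_compl_eq_one_sub ((h₀.union h₁).union h₂)]
  have h1 := measureReal_union_le (μ := μ) (E₀ ∪ E₁) E₂
  have h2 := measureReal_union_le (μ := μ) E₀ E₁
  linarith

theorem lla_converges_of_minEigen [IsProbabilityMeasure μ] (M : SCRModel Ω μ)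
    {a1 a2 γ lam τ : ℝ} {pen dpen : ℝ → ℝ} {init : Ω → M.Coef} (hlam : 0 ≤ lam) (hτ : 0 < τ)
    (hpen : IsFoldedConcave a1 a2 γ lam pen dpen) (hinit : Measurable init)
    (hsig : M.MinSignal γ lam) (h : M.MinEigen τ) :
    ∃ A : Set Ω, MeasurableSet A ∧
      1 - M.delta0 init (min 1 a2) lam - M.delta1 a1 lam - M.delta2 γ lam ≤ μ.real A ∧
      ∀ ω ∈ A, M.LLAConvergesTo dpen (M.y ω) (init ω) (M.oracle (M.y ω)) := by
  have m0 : MeasurableSet {ω | min 1 a2 * lam < ‖init ω - M.β‖} :=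
    measurableSet_lt measurable_const (hinit.sub_const _).norm
  have m1 := h.measurableSet_large_score hτ (a1 * lam)
  have m2 := h.measurableSet_small_oracle hτ (γ * lam)
  refine ⟨_, ((m0.union m1).union m2).compl, one_sub_le_measureReal_compl_union m0 m1 m2, ?_⟩
  intro ω hω
  simp only [Set.compl_union, Set.mem_inter_iff, Set.mem_compl_iff] at hω
  obtain ⟨⟨n0, n1⟩, n2⟩ := hω
  refine h.llaConvergesTo_oracle hτ hlam hpen hsig _ _ (not_lt.1 n0) ?_ ?_
  · intro k hk
    by_contra hc
    exact n1 ⟨k, hk, by rw [gradQ_eq_score]; exact not_lt.1 hc⟩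
  · intro k hk
    exact (not_lt.1 n2).trans (minAbs_le _ hk)

end SCRModel

/-! ### Exponential moments of sub-Gaussian quadratic forms -/

/-- `E exp X`, as an extended nonnegative real. -/
noncomputable def expMoment {Ω : Type*} [MeasurableSpace Ω] (μ : Measure Ω) (X : Ω → ℝ) : ENNReal :=
  ∫⁻ ω, ENNReal.ofReal (Real.exp (X ω)) ∂μ

section ExpMoment

variable {Ω : Type*} [MeasurableSpace Ω] {μ : Measure Ω}

lemma expMoment_mul_le {X : Ω → ℝ} {C : ℝ≥0} (h : HasSubgaussianMGF X C μ) (t : ℝ) :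
    expMoment μ (fun ω => t * X ω) ≤ ENNReal.ofReal (Real.exp (C * t ^ 2 / 2)) := by
  rw [expMoment, ← ofReal_integral_eq_lintegral_ofReal (h.integrable_exp_mul t)
    (ae_of_all _ fun _ => (Real.exp_pos _).le)]
  exact ENNReal.ofReal_le_ofReal (h.mgf_le t)

lemma expMoment_sum_eq_prod {ι : Type*} {Z : ι → Ω → ℝ} (hZ : iIndepFun Z μ)
    (hm : ∀ i, Measurable (Z i)) (s : Finset ι) {f : ι → ℝ → ℝ} (hf : ∀ i, Measurable (f i)) :
    expMoment μ (fun ω => ∑ i ∈ s, f i (Z i ω)) = ∏ i ∈ s, expMoment μ fun ω => f i (Z i ω) := by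
  have hg : ∀ i, Measurable fun x : ℝ => ENNReal.ofReal (Real.exp (f i x)) := fun i =>
    (hf i).exp.ennreal_ofReal
  have := lintegral_prod_eq_prod_lintegral_of_indepFun s
    (fun i ω => ENNReal.ofReal (Real.exp (f i (Z i ω)))) (hZ.comp _ hg) fun i => (hg i).comp (hm i)
  refine Eq.trans ?_ this
  refine lintegral_congr fun ω => ?_
  rw [Real.exp_sum, ENNReal.ofReal_prod_of_nonneg fun _ _ => (Real.exp_pos _).le]

lemma expMoment_sum_le {ι : Type*} {Z : ι → Ω → ℝ} (hZ : iIndepFun Z μ)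
    (hm : ∀ i, Measurable (Z i)) (s : Finset ι) {f : ι → ℝ → ℝ} (hf : ∀ i, Measurable (f i))
    {b : ι → ℝ} (hb : ∀ i ∈ s, expMoment μ (fun ω => f i (Z i ω)) ≤
      ENNReal.ofReal (Real.exp (b i))) :
    expMoment μ (fun ω => ∑ i ∈ s, f i (Z i ω)) ≤ ENNReal.ofReal (Real.exp (∑ i ∈ s, b i)) := by
  rw [expMoment_sum_eq_prod hZ hm s hf, Real.exp_sum,
    ENNReal.ofReal_prod_of_nonneg fun _ _ => (Real.exp_pos _).le]
  exact Finset.prod_le_prod' hb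

/-- Turns the value of the Gaussian integral below into an exponential. After squaring it follows
from `exp (2x) ≥ 1 + 2x + 2x²`. -/
lemma inv_sqrt_one_sub_le {x : ℝ} (h0 : 0 ≤ x) (h1 : x ≤ 1 / 2) :
    √((1 - x)⁻¹) ≤ Real.exp x := by
  rw [Real.sqrt_le_iff]
  refine ⟨(Real.exp_pos _).le, ?_⟩
  rw [← Real.exp_nat_mul, inv_le_comm₀ (by linarith) (Real.exp_pos _), ← Real.exp_neg]
  have h2 : Real.exp (-(2 * x)) ≤ 1 - x := by
    have h3 := Real.exp_bound_div_one_sub_of_interval (x := x) h0 (by linarith)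
    rw [Real.exp_neg, inv_le_comm₀ (Real.exp_pos _) (by linarith)]
    have h4 := Real.quadratic_le_exp_of_nonneg (x := 2 * x) (by linarith)
    refine le_trans ?_ h4
    rw [inv_le_iff_one_le_mul₀ (by linarith)]
    nlinarith [mul_nonneg h0 h0, mul_nonneg (mul_nonneg h0 h0) (sub_nonneg.2 h1)]
  simpa using h2

/-- The exponential moment of the square, by linearization with a Gaussian integral. -/
lemma expMoment_mul_sq_le [SFinite μ] {X : Ω → ℝ} {c : ℝ≥0} (hX : Measurable X)
    (h : HasSubgaussianMGF X (c ^ 2) μ) {s : ℝ} (hs : 0 ≤ s) (hsc : 4 * (c : ℝ) ^ 2 * s ≤ 1) :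
    expMoment μ (fun ω => s * X ω ^ 2) ≤ ENNReal.ofReal (Real.exp (2 * s * (c : ℝ) ^ 2)) := by
  set a := (√(2 * Real.pi))⁻¹ with ha
  have ha0 : 0 ≤ a := by positivity
  -- Completing the square: the integrand is `exp (s z²)` times the Gaussian density with mean
  -- `√(2s) z` and variance one.
  have hpt : ∀ z : ℝ, ENNReal.ofReal (Real.exp (s * z ^ 2))
      = ∫⁻ x, ENNReal.ofReal (a * Real.exp (-x ^ 2 / 2)) *
          ENNReal.ofReal (Real.exp (√(2 * s) * x * z)) := by
    intro z
    have h1 := lintegral_gaussianPDFReal_eq_one (√(2 * s) * z) (v := 1) one_ne_zero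
    rw [← mul_one (ENNReal.ofReal (Real.exp (s * z ^ 2))), ← h1, ← lintegral_const_mul']
    · refine lintegral_congr fun x => ?_
      rw [← ENNReal.ofReal_mul (Real.exp_pos _).le, ← ENNReal.ofReal_mul (by positivity)]
      congr 1
      rw [gaussianPDFReal, mul_assoc a, ← Real.exp_add]
      simp only [NNReal.coe_one, mul_one]
      rw [mul_left_comm, ← Real.exp_add]
      congr 2
      have h2 : √(2 * s) ^ 2 = 2 * s := Real.sq_sqrt (by positivity)
      linear_combination (-z ^ 2 / 2) * h2
    · exact ENNReal.ofReal_ne_top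
  rw [expMoment]
  simp_rw [hpt]
  rw [lintegral_lintegral_swap (by fun_prop)]
  have hb : 0 < 1 / 2 - (c : ℝ) ^ 2 * s := by linarith
  calc _ ≤ ∫⁻ x, ENNReal.ofReal (a * Real.exp (-x ^ 2 / 2)) *
          ENNReal.ofReal (Real.exp ((c : ℝ) ^ 2 * s * x ^ 2)) := by
        refine lintegral_mono fun x => ?_
        rw [lintegral_const_mul' _ _ ENNReal.ofReal_ne_top]
        gcongr
        refine (expMoment_mul_le h (√(2 * s) * x)).trans (le_of_eq ?_)
        congr 2
        rw [mul_pow, Real.sq_sqrt (by positivity)]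
        push_cast; ring
    _ = ∫⁻ x, ENNReal.ofReal (a * Real.exp (-(1 / 2 - (c : ℝ) ^ 2 * s) * x ^ 2)) := by
        refine lintegral_congr fun x => ?_
        rw [← ENNReal.ofReal_mul (by positivity), mul_assoc, ← Real.exp_add]
        congr 3; ring
    _ = ENNReal.ofReal (a * √(Real.pi / (1 / 2 - (c : ℝ) ^ 2 * s))) := by
        rw [← ofReal_integral_eq_lintegral_ofReal ((integrable_exp_neg_mul_sq hb).const_mul a)
          (ae_of_all _ fun _ => by positivity), integral_const_mul, integral_gaussian]
    _ ≤ _ := by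
        refine ENNReal.ofReal_le_ofReal ?_
        have e : a * √(Real.pi / (1 / 2 - (c : ℝ) ^ 2 * s)) = √((1 - 2 * s * (c : ℝ) ^ 2)⁻¹) := by
          rw [ha, ← Real.sqrt_inv, ← Real.sqrt_mul (by positivity)]
          congr 1
          have : 1 - 2 * s * (c : ℝ) ^ 2 ≠ 0 := by
            have : 0 < 1 - 2 * s * (c : ℝ) ^ 2 := by linarith
            exact this.ne'
          field_simp
        rw [e]
        exact inv_sqrt_one_sub_le (by positivity) (by linarith)

/-- The linear term is kept because it has expectation zero for a centered variable. -/
lemma exp_le_one_add_add (x : ℝ) : Real.exp x ≤ 1 + x + x ^ 2 * Real.exp |x| := by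
  have h := Complex.norm_exp_sub_sum_le_norm_mul_exp (x : ℂ) 2
  have e : Complex.exp (x : ℂ) - ∑ m ∈ Finset.range 2, (x : ℂ) ^ m / (m.factorial : ℂ)
      = ((Real.exp x - (1 + x) : ℝ) : ℂ) := by
    simp [Finset.sum_range_succ]
  rw [e, Complex.norm_real, Complex.norm_real, Real.norm_eq_abs, Real.norm_eq_abs, sq_abs] at h
  linarith [le_abs_self (Real.exp x - (1 + x))]

/-- The constant in the exponential moment of the centered square. -/
noncomputable def centeredSqConst (c : ℝ) : ℝ :=
  128 * c ^ 4 * Real.exp (1 / (4 * c ^ 2) + 1 / 2)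

lemma centeredSqConst_pos {c : ℝ} (hc : 0 < c) : 0 < centeredSqConst c := by
  unfold centeredSqConst; positivity

/-- Since `X² - 1` is centered, only the quadratic remainder survives integration, and the
exponential moment of `X²` at the largest admissible `s = 1 / (4c²)` pays for it. -/
lemma expMoment_mul_sq_sub_one_le [IsProbabilityMeasure μ] {X : Ω → ℝ} {c : ℝ≥0} (hc : 0 < c)
    (hX : Measurable X) (h : HasSubgaussianMGF X (c ^ 2) μ) (h2 : ∫ ω, X ω ^ 2 ∂μ = 1) {η : ℝ}
    (hη : 8 * (c : ℝ) ^ 2 * |η| ≤ 1) :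
    expMoment μ (fun ω => η * (X ω ^ 2 - 1))
      ≤ ENNReal.ofReal (Real.exp (centeredSqConst c * η ^ 2)) := by
  have hc' : (0 : ℝ) < c := hc
  set s : ℝ := 1 / (4 * (c : ℝ) ^ 2) with hs
  have hs0 : 0 < s := by positivity
  have hcs : 4 * (c : ℝ) ^ 2 * s = 1 := by rw [hs]; field_simp
  have hηs : |η| ≤ s / 2 := by
    rw [hs, div_div, le_div_iff₀ (by positivity)]; linarith
  have hE := expMoment_mul_sq_le hX h hs0.le hcs.le
  have hint : Integrable (fun ω => Real.exp (s * X ω ^ 2)) μ := by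
    refine ⟨by fun_prop, ?_⟩
    rw [hasFiniteIntegral_iff_ofReal (ae_of_all _ fun _ => (Real.exp_pos _).le)]
    exact hE.trans_lt ENNReal.ofReal_lt_top
  have hle : ∫ ω, Real.exp (s * X ω ^ 2) ∂μ ≤ Real.exp (1 / 2) := by
    rw [expMoment, ← ofReal_integral_eq_lintegral_ofReal hint
      (ae_of_all _ fun _ => (Real.exp_pos _).le),
      ENNReal.ofReal_le_ofReal_iff (Real.exp_pos _).le] at hE
    refine hE.trans (le_of_eq ?_)
    congr 1; linarith
  have hX2 : Integrable (fun ω => X ω ^ 2) μ := (h.memLp 2).integrable_sq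
  set B : ℝ := 8 / s ^ 2 * Real.exp s with hB
  have hpt : ∀ x : ℝ, Real.exp (η * (x ^ 2 - 1))
      ≤ 1 + η * (x ^ 2 - 1) + η ^ 2 * B * Real.exp (s * x ^ 2) := by
    intro x
    refine (exp_le_one_add_add _).trans (add_le_add_right ?_ _)
    set Y := |x ^ 2 - 1| with hY
    have hY0 : 0 ≤ Y := abs_nonneg _
    have hY1 : Y ≤ x ^ 2 + 1 := by
      rw [hY, abs_le]; constructor <;> nlinarith [sq_nonneg x]
    -- Half of the exponent `s * Y` absorbs the factor `Y ^ 2`; the other half covers `exp (|η| *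
    -- Y)`.
    have q := Real.quadratic_le_exp_of_nonneg (x := s / 2 * Y) (by positivity)
    have q1 : Y ^ 2 ≤ 8 / s ^ 2 * Real.exp (s / 2 * Y) := by
      rw [div_mul_eq_mul_div, le_div_iff₀ (by positivity)]
      nlinarith [mul_nonneg hs0.le hY0]
    calc (η * (x ^ 2 - 1)) ^ 2 * Real.exp |η * (x ^ 2 - 1)|
        = η ^ 2 * (Y ^ 2 * Real.exp (|η| * Y)) := by
          rw [abs_mul, mul_pow, hY, sq_abs]; ring
      _ ≤ η ^ 2 * (8 / s ^ 2 * Real.exp (s / 2 * Y) * Real.exp (s / 2 * Y)) := by gcongr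
      _ = η ^ 2 * (8 / s ^ 2) * Real.exp (s * Y) := by
          rw [mul_assoc (8 / s ^ 2), ← Real.exp_add, mul_assoc]; congr 3; ring
      _ ≤ η ^ 2 * (8 / s ^ 2) * Real.exp (s + s * x ^ 2) := by
          gcongr; nlinarith
      _ = _ := by rw [Real.exp_add, hB]; ring
  have hR : Integrable (fun ω => 1 + η * (X ω ^ 2 - 1) + η ^ 2 * B * Real.exp (s * X ω ^ 2)) μ :=
    ((integrable_const _).add ((hX2.sub (integrable_const _)).const_mul _)).add
      (hint.const_mul _)
  have hL : Integrable (fun ω => Real.exp (η * (X ω ^ 2 - 1))) μ := by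
    refine hR.mono' (by fun_prop) (ae_of_all _ fun ω => ?_)
    rw [Real.norm_eq_abs, abs_of_pos (Real.exp_pos _)]
    exact hpt _
  rw [expMoment, ← ofReal_integral_eq_lintegral_ofReal hL
    (ae_of_all _ fun _ => (Real.exp_pos _).le)]
  refine ENNReal.ofReal_le_ofReal ?_
  calc _ ≤ ∫ ω, (1 + η * (X ω ^ 2 - 1) + η ^ 2 * B * Real.exp (s * X ω ^ 2)) ∂μ :=
        integral_mono hL hR fun ω => hpt _
    _ = 1 + η ^ 2 * B * ∫ ω, Real.exp (s * X ω ^ 2) ∂μ := by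
        have i1 : Integrable (fun ω => X ω ^ 2 - 1) μ := hX2.sub (integrable_const _)
        have i2 : Integrable (fun ω => 1 + η * (X ω ^ 2 - 1)) μ :=
          (integrable_const _).add (i1.const_mul _)
        rw [integral_add i2 (hint.const_mul _), integral_add (integrable_const _)
          (i1.const_mul _), integral_const_mul, integral_const_mul,
          integral_sub hX2 (integrable_const _), h2]
        simp
    _ ≤ 1 + η ^ 2 * B * Real.exp (1 / 2) := by gcongr
    _ = 1 + centeredSqConst c * η ^ 2 := by
        rw [centeredSqConst, hB, Real.exp_add, ← hs]
        have : 8 / s ^ 2 = 128 * (c : ℝ) ^ 4 := by rw [hs]; field_simp; norm_num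
        rw [this]; ring
    _ ≤ _ := by
        have := Real.add_one_le_exp (centeredSqConst c * η ^ 2); linarith

/-- Conditioning on `U`, as Tonelli for the product of the two laws. -/
lemma lintegral_comp_indepFun [IsFiniteMeasure μ] {E F : Type*}
    [MeasurableSpace E] [MeasurableSpace F]
    {U : Ω → E} {V : Ω → F} (hUV : IndepFun U V μ) (hU : Measurable U) (hV : Measurable V)
    {f : E → F → ENNReal} (hf : Measurable (Function.uncurry f)) :
    ∫⁻ ω, f (U ω) (V ω) ∂μ = ∫⁻ ω, ∫⁻ ω', f (U ω) (V ω') ∂μ ∂μ := by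
  have h1 := (indepFun_iff_map_prod_eq_prod_map_map hU.aemeasurable hV.aemeasurable).1 hUV
  have h2 : ∫⁻ ω, f (U ω) (V ω) ∂μ
      = ∫⁻ z, Function.uncurry f z ∂(μ.map fun ω => (U ω, V ω)) := by
    rw [lintegral_map hf (hU.prodMk hV)]; rfl
  rw [h2, h1, lintegral_prod _ hf.aemeasurable, lintegral_map hf.lintegral_prod_right' hU]
  refine lintegral_congr fun ω => ?_
  exact lintegral_map (hf.comp measurable_prodMk_left) hV

end ExpMoment

/-! ### Decoupling by averaging over subsets of coordinates. -/

section Decoupling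

variable {n : Type*} [DecidableEq n]

/-- The sign of `i` in the sign vector with positive part `I`. -/
def signOf (I : Finset n) (i : n) : ℝ := if i ∈ I then 1 else -1

lemma signOf_symmDiff_self (I : Finset n) (i : n) : signOf (symmDiff I {i}) i = -signOf I i := by
  by_cases h : i ∈ I <;> simp [signOf, Finset.mem_symmDiff, h]

lemma signOf_symmDiff_of_ne (I : Finset n) {i j : n} (hij : i ≠ j) :
    signOf (symmDiff I {i}) j = signOf I j := by
  simp [signOf, Finset.mem_symmDiff, hij.symm]

variable [Fintype n]

/-- Toggling the membership of `i` is a bijection on subsets that negates every summand. -/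
lemma sum_eq_zero_of_flip (i : n) (f : Finset n → ℝ)
    (hf : ∀ I, f (symmDiff I {i}) = -f I) : ∑ I, f I = 0 := by
  have h : ∑ I : Finset n, f (symmDiff I {i}) = ∑ I, f I :=
    Equiv.sum_comp (Function.Involutive.toPerm (fun I : Finset n => symmDiff I {i})
      (fun I => symmDiff_symmDiff_cancel_right {i} I)) f
  simp only [hf, Finset.sum_neg_distrib] at h
  linarith

/-- A uniform random subset contains `i` and misses `j ≠ i` with probability 1/4. The indicators are
expanded in signs, and all nonconstant terms cancel. -/
lemma sum_indicator_pair (i j : n) :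
    ∑ I : Finset n, 4 * ((if i ∈ I then 1 else 0) * (if j ∈ I then 0 else 1) : ℝ)
      = if i = j then 0 else 2 ^ Fintype.card n := by
  have h : ∀ I : Finset n, 4 * ((if i ∈ I then 1 else 0) * (if j ∈ I then 0 else 1) : ℝ)
      = 1 + signOf I i - signOf I j - signOf I i * signOf I j := by
    intro I
    by_cases h1 : i ∈ I <;> by_cases h2 : j ∈ I <;> (simp [signOf, h1, h2]; try norm_num)
  split_ifs with hij
  · subst hij
    refine Finset.sum_eq_zero fun I _ => ?_
    by_cases h1 : i ∈ I <;> simp [h1]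
  · simp only [h, Finset.sum_sub_distrib, Finset.sum_add_distrib]
    rw [sum_eq_zero_of_flip i (fun I => signOf I i) fun I => signOf_symmDiff_self I i,
      sum_eq_zero_of_flip j (fun I => signOf I j) fun I => signOf_symmDiff_self I j,
      sum_eq_zero_of_flip i (fun I => signOf I i * signOf I j) fun I => by
        rw [signOf_symmDiff_self, signOf_symmDiff_of_ne I hij, neg_mul]]
    simp

/-- The part of the quadratic form of `A` that couples `I` with its complement. -/
def crossForm (A : Matrix n n ℝ) (I : Finset n) (z : n → ℝ) : ℝ :=
  ∑ j ∈ Iᶜ, (∑ i ∈ I, A i j * z i) * z j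

/-- The off-diagonal part of the quadratic form of `A`. -/
def offDiagForm (A : Matrix n n ℝ) (z : n → ℝ) : ℝ :=
  ∑ i, ∑ j, if i = j then 0 else A i j * z i * z j

lemma sum_crossForm (A : Matrix n n ℝ) (z : n → ℝ) :
    ∑ I : Finset n, ((2 : ℝ) ^ Fintype.card n)⁻¹ * (4 * crossForm A I z) = offDiagForm A z := by
  have h : ∀ I : Finset n, 4 * crossForm A I z = ∑ i, ∑ j,
      4 * ((if i ∈ I then 1 else 0) * (if j ∈ I then 0 else 1)) * (A i j * z i * z j) := by
    intro I
    rw [crossForm, Finset.mul_sum, Finset.sum_comm,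
      ← Finset.sum_subset (Finset.subset_univ Iᶜ)]
    · refine Finset.sum_congr rfl fun j hj => ?_
      rw [Finset.sum_mul, Finset.mul_sum, ← Finset.sum_subset (Finset.subset_univ I)]
      · refine Finset.sum_congr rfl fun i hi => ?_
        rw [Finset.mem_compl] at hj
        simp [hi, hj]
      · intro i _ hi; simp [hi]
    · intro j _ hj
      rw [Finset.mem_compl, not_not] at hj
      simp [hj]
  rw [← Finset.mul_sum]
  simp only [h]
  rw [Finset.sum_comm, offDiagForm, Finset.mul_sum]
  refine Finset.sum_congr rfl fun i _ => ?_
  rw [Finset.sum_comm, Finset.mul_sum]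
  refine Finset.sum_congr rfl fun j _ => ?_
  rw [← Finset.sum_mul, sum_indicator_pair]
  split_ifs with hij
  · simp
  · field_simp

/-- Jensen's inequality for the average over subsets in `sum_crossForm`. -/
lemma exp_offDiagForm_le (A : Matrix n n ℝ) (z : n → ℝ) (θ : ℝ) :
    Real.exp (θ * offDiagForm A z)
      ≤ ∑ I : Finset n, ((2 : ℝ) ^ Fintype.card n)⁻¹ * Real.exp (4 * θ * crossForm A I z) := by
  have h := convexOn_exp.map_sum_le (t := (Finset.univ : Finset (Finset n)))
    (w := fun _ => ((2 : ℝ) ^ Fintype.card n)⁻¹) (p := fun I => 4 * θ * crossForm A I z)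
    (fun _ _ => by positivity) (by simp) (fun _ _ => Set.mem_univ _)
  simp only [smul_eq_mul] at h
  refine le_trans (le_of_eq ?_) h
  rw [← sum_crossForm, Finset.mul_sum]
  congr 1
  refine Finset.sum_congr rfl fun I _ => ?_
  ring

end Decoupling

/-! ### Exponential moments and tails of centered quadratic forms. -/

section QuadraticForm

variable {Ω : Type*} [MeasurableSpace Ω] {μ : Measure Ω}
  {n : Type*} [Fintype n] {Z : Ω → n → ℝ} {c : ℝ≥0}

/-- The centered quadratic form of `A`. -/
def centeredForm (A : Matrix n n ℝ) (z : n → ℝ) : ℝ := (∑ i, ∑ j, A i j * z i * z j) - A.trace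

lemma centeredForm_neg (A : Matrix n n ℝ) (z : n → ℝ) :
    centeredForm (-A) z = -centeredForm A z := by
  simp [centeredForm, neg_add_eq_sub]

variable [DecidableEq n]

/-- Given the coordinates in `I`, the form is linear in the independent ones outside `I`. Their
sub-Gaussian bound produces the squared norm of the coefficient vector, which the Schur test,
applied to `Z` truncated to `I`, bounds by `m²` times the sum of squares. -/
lemma expMoment_crossForm_le [IsProbabilityMeasure μ] (hZm : Measurable Z)
    (hZ : iIndepFun (fun j ω => Z ω j) μ)
    (hsub : ∀ j, HasSubgaussianMGF (fun ω => Z ω j) (c ^ 2) μ)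
    (A : Matrix n n ℝ) (hA : A.IsSymm) {m : ℝ} (hm : matOneNorm A ≤ m) (I : Finset n) (t : ℝ) :
    expMoment μ (fun ω => t * crossForm A I (Z ω))
      ≤ expMoment μ fun ω => ∑ i, (c : ℝ) ^ 2 * t ^ 2 * m ^ 2 / 2 * Z ω i ^ 2 := by
  have hZj : ∀ j, Measurable fun ω => Z ω j := fun j => measurable_pi_iff.1 hZm j
  have hind := hZ.indepFun_finset I Iᶜ disjoint_compl_right hZj
  let f : (I → ℝ) → ((Iᶜ : Finset n) → ℝ) → ENNReal := fun u v =>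
    ENNReal.ofReal (Real.exp (t * ∑ j : (Iᶜ : Finset n), (∑ i : I, A i j * u i) * v j))
  have hf : Measurable (Function.uncurry f) := by
    unfold f Function.uncurry
    fun_prop
  have e1 : expMoment μ (fun ω => t * crossForm A I (Z ω))
      = ∫⁻ ω, f (fun i => Z ω i) (fun j => Z ω j) ∂μ := by
    refine lintegral_congr fun ω => ?_
    simp only [f, crossForm]
    rw [← Finset.sum_coe_sort Iᶜ]
    simp only [← Finset.sum_coe_sort I]
  rw [e1, lintegral_comp_indepFun hind (measurable_pi_iff.2 fun i => hZj i)
    (measurable_pi_iff.2 fun i => hZj i) hf]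
  refine lintegral_mono fun ω => ?_
  set x : n → ℝ := fun j => ∑ i ∈ I, A i j * Z ω i with hx
  have e2 : ∫⁻ ω', f (fun i => Z ω i) (fun j => Z ω' j) ∂μ
      = expMoment μ fun ω' => ∑ j ∈ Iᶜ, (t * x j) * Z ω' j := by
    refine lintegral_congr fun ω' => ?_
    simp only [f, hx]
    rw [← Finset.sum_coe_sort Iᶜ, Finset.mul_sum]
    simp only [← Finset.sum_coe_sort I, mul_assoc]
  rw [e2]
  refine (expMoment_sum_le hZ hZj Iᶜ (f := fun j z => (t * x j) * z) (fun j => by fun_prop)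
    (b := fun j => ((c ^ 2 : ℝ≥0) : ℝ) * (t * x j) ^ 2 / 2)
    fun j _ => expMoment_mul_le (hsub j) _).trans ?_
  refine ENNReal.ofReal_le_ofReal (Real.exp_le_exp.2 ?_)
  have h1 : ∑ j ∈ Iᶜ, x j ^ 2 ≤ m ^ 2 * ∑ i, Z ω i ^ 2 := by
    have hS := sum_mulVec_sq_le A hA (fun i => if i ∈ I then Z ω i else 0)
    have hx' : ∀ j, ∑ i, A i j * (if i ∈ I then Z ω i else 0) = x j := by
      intro j
      simp [hx, Finset.sum_ite_mem]
    simp only [hx'] at hS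
    calc ∑ j ∈ Iᶜ, x j ^ 2 ≤ ∑ j, x j ^ 2 :=
          Finset.sum_le_sum_of_subset_of_nonneg (Finset.subset_univ _) fun _ _ _ => sq_nonneg _
      _ ≤ _ := hS
      _ ≤ _ := by
          have := matOneNorm_nonneg A
          refine mul_le_mul (pow_le_pow_left₀ this hm 2) (Finset.sum_le_sum fun i _ => ?_)
            (Finset.sum_nonneg fun _ _ => sq_nonneg _) (sq_nonneg _)
          split_ifs
          · exact le_rfl
          · rw [zero_pow two_ne_zero]; exact sq_nonneg _
  calc ∑ j ∈ Iᶜ, ((c ^ 2 : ℝ≥0) : ℝ) * (t * x j) ^ 2 / 2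
      = (c : ℝ) ^ 2 * t ^ 2 / 2 * ∑ j ∈ Iᶜ, x j ^ 2 := by
        rw [Finset.mul_sum]
        refine Finset.sum_congr rfl fun j _ => ?_
        push_cast; ring
    _ ≤ (c : ℝ) ^ 2 * t ^ 2 / 2 * (m ^ 2 * ∑ i, Z ω i ^ 2) := by gcongr
    _ = ∑ i, (c : ℝ) ^ 2 * t ^ 2 * m ^ 2 / 2 * Z ω i ^ 2 := by rw [← Finset.mul_sum]; ring

lemma expMoment_offDiagForm_le [IsProbabilityMeasure μ] (hZm : Measurable Z)
    (hZ : iIndepFun (fun j ω => Z ω j) μ)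
    (hsub : ∀ j, HasSubgaussianMGF (fun ω => Z ω j) (c ^ 2) μ)
    (A : Matrix n n ℝ) (hA : A.IsSymm) {m : ℝ} (hm : matOneNorm A ≤ m) {θ : ℝ}
    (hθ : 32 * (c : ℝ) ^ 4 * θ ^ 2 * m ^ 2 ≤ 1) :
    expMoment μ (fun ω => θ * offDiagForm A (Z ω))
      ≤ ENNReal.ofReal (Real.exp (Fintype.card n * (16 * (c : ℝ) ^ 4 * θ ^ 2 * m ^ 2))) := by
  have hZj : ∀ j, Measurable fun ω => Z ω j := fun j => measurable_pi_iff.1 hZm j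
  set B := ENNReal.ofReal (Real.exp (Fintype.card n * (16 * (c : ℝ) ^ 4 * θ ^ 2 * m ^ 2))) with hB
  have hI : ∀ I, expMoment μ (fun ω => 4 * θ * crossForm A I (Z ω)) ≤ B := by
    intro I
    refine (expMoment_crossForm_le hZm hZ hsub A hA hm I (4 * θ)).trans ?_
    -- Each square has coefficient `s = 8c²θ²m²`; `hθ` is `4c²s ≤ 1`, and the exponent per
    -- coordinate is `2sc²`.
    refine (expMoment_sum_le hZ hZj Finset.univ
      (f := fun _ z => (c : ℝ) ^ 2 * (4 * θ) ^ 2 * m ^ 2 / 2 * z ^ 2) (fun j => by fun_prop)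
      (b := fun _ => 16 * (c : ℝ) ^ 4 * θ ^ 2 * m ^ 2) fun j _ => ?_).trans (le_of_eq ?_)
    · refine (expMoment_mul_sq_le (hZj j) (hsub j) (by positivity) ?_).trans (le_of_eq ?_)
      · linarith
      · congr 2; ring
    · simp [hB]
  have hcm : ∀ I, Measurable fun ω => crossForm A I (Z ω) := by
    intro I; unfold crossForm; fun_prop
  calc expMoment μ (fun ω => θ * offDiagForm A (Z ω))
      ≤ ∫⁻ ω, ∑ I : Finset n, ENNReal.ofReal ((2 : ℝ) ^ Fintype.card n)⁻¹
          * ENNReal.ofReal (Real.exp (4 * θ * crossForm A I (Z ω))) ∂μ := by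
        refine lintegral_mono fun ω => ?_
        refine (ENNReal.ofReal_le_ofReal (exp_offDiagForm_le A (Z ω) θ)).trans (le_of_eq ?_)
        rw [ENNReal.ofReal_sum_of_nonneg fun _ _ => by positivity]
        refine Finset.sum_congr rfl fun I _ => ?_
        rw [ENNReal.ofReal_mul (by positivity)]
    _ = ∑ I : Finset n, ENNReal.ofReal ((2 : ℝ) ^ Fintype.card n)⁻¹
          * expMoment μ (fun ω => 4 * θ * crossForm A I (Z ω)) := by
        rw [lintegral_finsetSum _ fun I _ => by
          have := hcm I
          fun_prop]
        refine Finset.sum_congr rfl fun I _ => ?_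
        rw [lintegral_const_mul' _ _ ENNReal.ofReal_ne_top, expMoment]
    _ ≤ ∑ _I : Finset n, ENNReal.ofReal ((2 : ℝ) ^ Fintype.card n)⁻¹ * B := by
        gcongr with I; exact hI I
    _ = B := by
        rw [← Finset.sum_mul, ← ENNReal.ofReal_sum_of_nonneg fun _ _ => by positivity]
        simp

lemma centeredForm_eq (A : Matrix n n ℝ) (z : n → ℝ) :
    centeredForm A z = (∑ i, A i i * (z i ^ 2 - 1)) + offDiagForm A z := by
  have h : ∀ i, ∑ j, A i j * z i * z j
      = A i i * z i ^ 2 + ∑ j, if i = j then 0 else A i j * z i * z j := by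
    intro i
    have : ∀ j, A i j * z i * z j
        = (if i = j then A i i * z i ^ 2 else 0) + if i = j then 0 else A i j * z i * z j := by
      intro j
      split_ifs with hij
      · subst hij; ring
      · ring
    rw [Finset.sum_congr rfl fun j _ => this j, Finset.sum_add_distrib]
    simp
  simp only [centeredForm, offDiagForm, h, Finset.sum_add_distrib, mul_sub, mul_one,
    Finset.sum_sub_distrib, Matrix.trace, Matrix.diag]
  ring

/-- The variance factor of a quadratic form in sub-Gaussian variables. -/
noncomputable def quadConst (c : ℝ) : ℝ := 4 * centeredSqConst c + 64 * c ^ 4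

lemma quadConst_pos {c : ℝ} (hc : 0 < c) : 0 < quadConst c := by
  have := centeredSqConst_pos hc
  unfold quadConst; positivity

/-- The diagonal and off-diagonal parts are dependent, so they are separated by `exp (u + v) ≤ (exp
(2u) + exp (2v)) / 2`. Doubling `θ` gives the factors 4 and 64 = 4 · 16 in `quadConst`, a sum that
dominates both parts. -/
lemma expMoment_centeredForm_le [IsProbabilityMeasure μ] (hc : 0 < c) (hZm : Measurable Z)
    (hZ : iIndepFun (fun j ω => Z ω j) μ)
    (hsub : ∀ j, HasSubgaussianMGF (fun ω => Z ω j) (c ^ 2) μ)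
    (hvar : ∀ j, ∫ ω, Z ω j ^ 2 ∂μ = 1)
    (A : Matrix n n ℝ) (hA : A.IsSymm) {m : ℝ} (hm : matOneNorm A ≤ m) {θ : ℝ}
    (hθ : 16 * (c : ℝ) ^ 2 * (|θ| * m) ≤ 1) :
    expMoment μ (fun ω => θ * centeredForm A (Z ω))
      ≤ ENNReal.ofReal (Real.exp (Fintype.card n * (quadConst c * θ ^ 2 * m ^ 2))) := by
  have hc' : (0 : ℝ) < c := hc
  have hm0 : 0 ≤ m := (matOneNorm_nonneg A).trans hm
  have hZj : ∀ j, Measurable fun ω => Z ω j := fun j => measurable_pi_iff.1 hZm j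
  have hsq : 256 * (c : ℝ) ^ 4 * θ ^ 2 * m ^ 2 ≤ 1 := by
    have h0 : 0 ≤ 16 * (c : ℝ) ^ 2 * (|θ| * m) := by positivity
    have := pow_le_one₀ (n := 2) h0 hθ
    calc _ = (16 * (c : ℝ) ^ 2 * (|θ| * m)) ^ 2 := by
          rw [mul_pow, mul_pow, mul_pow, sq_abs]; ring
      _ ≤ 1 := this
  set B := ENNReal.ofReal (Real.exp (Fintype.card n * (quadConst c * θ ^ 2 * m ^ 2))) with hB
  have hcs := centeredSqConst_pos hc'
  have hdiag : expMoment μ (fun ω => ∑ i, 2 * θ * A i i * (Z ω i ^ 2 - 1)) ≤ B := by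
    refine (expMoment_sum_le hZ hZj Finset.univ (f := fun i z => 2 * θ * A i i * (z ^ 2 - 1))
      (fun j => by fun_prop) (b := fun _ => 4 * centeredSqConst c * θ ^ 2 * m ^ 2)
      fun j _ => ?_).trans ?_
    · have hAj : |A j j| ≤ m := (abs_apply_le_matOneNorm A j j).trans hm
      refine (expMoment_mul_sq_sub_one_le hc (hZj j) (hsub j) (hvar j) ?_).trans ?_
      · rw [abs_mul, abs_mul, abs_two]
        calc _ = 16 * (c : ℝ) ^ 2 * (|θ| * |A j j|) := by ring
          _ ≤ 16 * (c : ℝ) ^ 2 * (|θ| * m) := by gcongr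
          _ ≤ 1 := hθ
      · refine ENNReal.ofReal_le_ofReal (Real.exp_le_exp.2 ?_)
        have : A j j ^ 2 ≤ m ^ 2 := by
          rw [← sq_abs]; exact pow_le_pow_left₀ (abs_nonneg _) hAj 2
        calc _ = 4 * centeredSqConst c * θ ^ 2 * A j j ^ 2 := by ring
          _ ≤ _ := by gcongr
    · refine ENNReal.ofReal_le_ofReal (Real.exp_le_exp.2 ?_)
      rw [Finset.sum_const, nsmul_eq_mul, Finset.card_univ, quadConst]
      gcongr
      have : 0 < (c : ℝ) ^ 4 := by positivity
      linarith
  have hoff : expMoment μ (fun ω => 2 * θ * offDiagForm A (Z ω)) ≤ B := by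
    refine (expMoment_offDiagForm_le hZm hZ hsub A hA hm (θ := 2 * θ) ?_).trans ?_
    · have : 0 ≤ (c : ℝ) ^ 4 * θ ^ 2 * m ^ 2 := by positivity
      nlinarith
    · refine ENNReal.ofReal_le_ofReal (Real.exp_le_exp.2 ?_)
      rw [quadConst]
      refine mul_le_mul_of_nonneg_left ?_ (Nat.cast_nonneg _)
      have h0 : 0 ≤ centeredSqConst c * θ ^ 2 * m ^ 2 := by positivity
      nlinarith
  have hpt : ∀ ω, ENNReal.ofReal (Real.exp (θ * centeredForm A (Z ω)))
      ≤ ENNReal.ofReal (1 / 2) * ENNReal.ofReal (Real.exp (∑ i, 2 * θ * A i i * (Z ω i ^ 2 - 1)))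
        + ENNReal.ofReal (1 / 2) * ENNReal.ofReal (Real.exp (2 * θ * offDiagForm A (Z ω))) := by
    intro ω
    rw [← ENNReal.ofReal_mul (by norm_num), ← ENNReal.ofReal_mul (by norm_num),
      ← ENNReal.ofReal_add (by positivity) (by positivity)]
    refine ENNReal.ofReal_le_ofReal ?_
    have h := convexOn_exp.2 (Set.mem_univ (∑ i, 2 * θ * A i i * (Z ω i ^ 2 - 1)))
      (Set.mem_univ (2 * θ * offDiagForm A (Z ω))) (by norm_num : (0 : ℝ) ≤ 1 / 2)
      (by norm_num : (0 : ℝ) ≤ 1 / 2) (by norm_num)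
    simp only [smul_eq_mul] at h
    refine le_trans (le_of_eq ?_) h
    rw [centeredForm_eq]
    congr 1
    rw [mul_add, Finset.mul_sum, Finset.mul_sum]
    congr 1
    · refine Finset.sum_congr rfl fun i _ => ?_; ring
    · ring
  refine (lintegral_mono hpt).trans ?_
  rw [lintegral_add_left (by fun_prop), lintegral_const_mul' _ _ ENNReal.ofReal_ne_top,
    lintegral_const_mul' _ _ ENNReal.ofReal_ne_top]
  calc _ ≤ ENNReal.ofReal (1 / 2) * B + ENNReal.ofReal (1 / 2) * B := by
        gcongr
        · exact hdiag
        · exact hoff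
    _ = B := by
        rw [← add_mul, ← ENNReal.ofReal_add (by norm_num) (by norm_num)]; norm_num

/-- Chernoff's bound. The unconstrained optimum `θ = t / (2vm²)` gives the quadratic regime when it
is admissible; otherwise the endpoint `θ = h / m` gives the linear one. -/
lemma measureReal_le_exp_of_expMoment_le [IsProbabilityMeasure μ] {X : Ω → ℝ} (hX : Measurable X)
    {N v m h t : ℝ} (hN : 0 ≤ N) (hv : 0 < v) (hm : 0 < m) (hh : 0 < h) (ht : 0 ≤ t)
    (hexp : ∀ θ, 0 ≤ θ → θ * m ≤ h →
      expMoment μ (fun ω => θ * X ω) ≤ ENNReal.ofReal (Real.exp (N * (v * θ ^ 2 * m ^ 2)))) :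
    μ.real {ω | N * t ≤ X ω}
      ≤ Real.exp (-min (1 / (4 * v) * N * t ^ 2 / m ^ 2) (h / 2 * N * t / m)) := by
  have chernoff : ∀ θ, 0 ≤ θ → θ * m ≤ h →
      μ.real {ω | N * t ≤ X ω} ≤ Real.exp (N * (v * θ ^ 2 * m ^ 2) - θ * (N * t)) := by
    intro θ h0 h1
    have hmk := mul_meas_ge_le_lintegral (μ := μ)
      (f := fun ω => ENNReal.ofReal (Real.exp (θ * X ω))) (by fun_prop)
      (ENNReal.ofReal (Real.exp (θ * (N * t))))
    have hsub : μ {ω | N * t ≤ X ω} ≤ μ {ω | ENNReal.ofReal (Real.exp (θ * (N * t)))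
        ≤ ENNReal.ofReal (Real.exp (θ * X ω))} := by
      refine measure_mono fun ω hω => ?_
      exact ENNReal.ofReal_le_ofReal (Real.exp_le_exp.2 (mul_le_mul_of_nonneg_left hω h0))
    have h2 := ((mul_le_mul_right hsub (ENNReal.ofReal (Real.exp (θ * (N * t))))).trans hmk).trans
      (hexp θ h0 h1)
    have h3 := ENNReal.toReal_mono ENNReal.ofReal_ne_top h2
    rw [ENNReal.toReal_mul, ENNReal.toReal_ofReal (Real.exp_pos _).le,
      ENNReal.toReal_ofReal (Real.exp_pos _).le] at h3
    rw [Real.exp_sub, le_div_iff₀ (Real.exp_pos _), mul_comm]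
    exact h3
  rcases le_total (t / (2 * v * m)) h with hcase | hcase
  · refine (chernoff (t / (2 * v * m ^ 2)) (by positivity) ?_).trans ?_
    · refine le_trans (le_of_eq ?_) hcase
      field_simp
    · refine Real.exp_le_exp.2 ?_
      refine le_trans (le_of_eq ?_) (neg_le_neg (min_le_left _ _))
      field_simp
      ring
  · refine (chernoff (h / m) (by positivity) (by field_simp; exact le_rfl)).trans ?_
    refine Real.exp_le_exp.2 (le_trans ?_ (neg_le_neg (min_le_right _ _)))
    have h1 : h * (2 * v * m) ≤ t := (le_div_iff₀ (by positivity)).1 hcase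
    have e1 : N * (v * (h / m) ^ 2 * m ^ 2) - h / m * (N * t)
        = N * h / m * (v * h * m - t) := by field_simp
    have e2 : -(h / 2 * N * t / m) = N * h / m * (-(t / 2)) := by field_simp
    rw [e1, e2]
    refine mul_le_mul_of_nonneg_left ?_ (by positivity)
    linarith

/-- A Hanson–Wright inequality with the maximal column sum in place of the operator norm. -/
lemma measureReal_abs_centeredForm_ge_le [IsProbabilityMeasure μ] (hc : 0 < c) (hZm : Measurable Z)
    (hZ : iIndepFun (fun j ω => Z ω j) μ)
    (hsub : ∀ j, HasSubgaussianMGF (fun ω => Z ω j) (c ^ 2) μ)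
    (hvar : ∀ j, ∫ ω, Z ω j ^ 2 ∂μ = 1)
    (A : Matrix n n ℝ) (hA : A.IsSymm) {m t : ℝ} (hm : matOneNorm A ≤ m) (hm0 : 0 < m)
    (ht : 0 ≤ t) :
    μ.real {ω | Fintype.card n * t ≤ |centeredForm A (Z ω)|}
      ≤ 2 * Real.exp (-min (1 / (4 * quadConst c) * Fintype.card n * t ^ 2 / m ^ 2)
        (1 / (32 * (c : ℝ) ^ 2) * Fintype.card n * t / m)) := by
  have hc' : (0 : ℝ) < c := hc
  have key : ∀ A : Matrix n n ℝ, A.IsSymm → matOneNorm A ≤ m →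
      μ.real {ω | Fintype.card n * t ≤ centeredForm A (Z ω)}
      ≤ Real.exp (-min (1 / (4 * quadConst c) * Fintype.card n * t ^ 2 / m ^ 2)
        (1 / (32 * (c : ℝ) ^ 2) * Fintype.card n * t / m)) := by
    intro A hA hm
    have := measureReal_le_exp_of_expMoment_le (μ := μ) (X := fun ω => centeredForm A (Z ω))
      (by unfold centeredForm; fun_prop) (N := Fintype.card n) (v := quadConst c) (m := m)
      (h := 1 / (16 * (c : ℝ) ^ 2)) (t := t) (by positivity) (quadConst_pos hc') hm0
      (by positivity) ht fun θ h0 h1 => by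
        refine expMoment_centeredForm_le hc hZm hZ hsub hvar A hA hm ?_
        rw [abs_of_nonneg h0]
        rw [le_div_iff₀ (by positivity)] at h1
        linarith
    refine this.trans (le_of_eq ?_)
    rw [show 1 / (16 * (c : ℝ) ^ 2) / 2 = 1 / (32 * (c : ℝ) ^ 2) by rw [div_div]; ring]
  have h1 := key A hA hm
  have h2 := key (-A) (by rw [Matrix.IsSymm, Matrix.transpose_neg, hA])
    (le_trans (le_of_eq (by simp [matOneNorm])) hm)
  have hsubset : {ω | Fintype.card n * t ≤ |centeredForm A (Z ω)|}
      ⊆ {ω | Fintype.card n * t ≤ centeredForm A (Z ω)}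
        ∪ {ω | Fintype.card n * t ≤ centeredForm (-A) (Z ω)} := by
    intro ω hω
    simp only [centeredForm_neg, Set.mem_union]
    exact le_abs.1 (Set.mem_ofPred_eq ▸ hω)
  refine (measureReal_mono hsubset).trans ((measureReal_union_le _ _).trans ?_)
  linarith

end QuadraticForm

/-! ### Tail bounds for the model -/

namespace SCRModel

variable {Ω : Type*} [MeasurableSpace Ω] {μ : Measure Ω}

/-- Rate constant of the Gaussian regime of the tail bound. -/
noncomputable def quadRate (c : ℝ) : ℝ := 1 / (4 * quadConst c)

/-- Rate constant of the exponential regime of the tail bound. -/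
noncomputable def linRate (c : ℝ) : ℝ := 1 / (32 * c ^ 2)

lemma quadRate_pos {c : ℝ} (hc : 0 < c) : 0 < quadRate c := by
  have := quadConst_pos hc
  unfold quadRate; positivity

lemma linRate_pos {c : ℝ} (hc : 0 < c) : 0 < linRate c := by
  unfold linRate; positivity

/-- The tail bound for one coordinate of the score at the truth. -/
noncomputable def scoreTail (M : SCRModel Ω μ) (c w σmax t : ℝ) : ℝ :=
  2 * Real.exp (-min (quadRate c * M.p * t ^ 2 / (w ^ 2 * σmax ^ 2))
    (linRate c * M.p * t / (w * σmax)))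

lemma frobInner_vecMulVec_mulVec {n : Type*} [Fintype n] (B A : Matrix n n ℝ) (hB : B.IsSymm)
    (z : n → ℝ) :
    frobInner (Matrix.vecMulVec (B.mulVec z) (B.mulVec z)) A
      = ∑ i, ∑ j, (B * A * B) i j * z i * z j := by
  have h1 : ∀ u : n → ℝ, frobInner (Matrix.vecMulVec u u) A = u ⬝ᵥ A.mulVec u := by
    intro u
    simp only [frobInner, Matrix.vecMulVec_apply, dotProduct, Matrix.mulVec, Finset.mul_sum]
    refine Finset.sum_congr rfl fun i _ => Finset.sum_congr rfl fun j _ => ?_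
    ring
  have h2 : ∑ i, ∑ j, (B * A * B) i j * z i * z j = z ⬝ᵥ (B * A * B).mulVec z := by
    simp only [dotProduct, Matrix.mulVec, Finset.mul_sum]
    refine Finset.sum_congr rfl fun i _ => Finset.sum_congr rfl fun j _ => ?_
    ring
  rw [h1, h2, ← Matrix.mulVec_mulVec, ← Matrix.mulVec_mulVec,
    Matrix.dotProduct_mulVec z B, ← Matrix.mulVec_transpose, hB.eq]

lemma isSymm_conj {n : Type*} [Fintype n] {B A : Matrix n n ℝ} (hB : B.IsSymm) (hA : A.IsSymm) :
    (B * A * B).IsSymm := by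
  rw [Matrix.IsSymm, Matrix.transpose_mul, Matrix.transpose_mul, hB.eq, hA.eq, Matrix.mul_assoc]

lemma SubGaussian.sqrt_mul_self {M : SCRModel Ω μ} {c : ℝ≥0} {σmin : ℝ}
    (h : M.SubGaussian c σmin) (hσ : 0 < σmin) :
    matSqrt (M.cov M.β) * matSqrt (M.cov M.β) = M.cov M.β :=
  matSqrt_mul_self (M.cov_isSymm _) (hσ.trans h.2).le

lemma BoundedL1.matOneNorm_conj_le {M : SCRModel Ω μ} {w σmax : ℝ} (h : M.BoundedL1 w σmax)
    (hw : 0 < w) (hσ : 0 < σmax) {A : Matrix (Fin M.p) (Fin M.p) ℝ} (hA : matOneNorm A ≤ w) :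
    matOneNorm (matSqrt (M.cov M.β) * A * matSqrt (M.cov M.β)) ≤ w * σmax := by
  set B := matSqrt (M.cov M.β)
  calc matOneNorm (B * A * B) ≤ matOneNorm (B * A) * matOneNorm B := matOneNorm_mul_le _ _
    _ ≤ matOneNorm B * matOneNorm A * matOneNorm B :=
        mul_le_mul_of_nonneg_right (matOneNorm_mul_le _ _) (matOneNorm_nonneg _)
    _ ≤ √σmax * w * √σmax :=
        mul_le_mul (mul_le_mul h.2 hA (matOneNorm_nonneg _) (Real.sqrt_nonneg _)) h.2
          (matOneNorm_nonneg _) (by positivity)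
    _ = w * σmax := by
        rw [mul_right_comm, Real.mul_self_sqrt hσ.le, mul_comm]

/-- With `B = Σ₀^{1/2}`, minus `p` times the score is the centered form of `B W_k B` at `Z`:
cyclicity of the trace and `B² = Σ₀` identify the centering. -/
lemma score_tail_le [IsProbabilityMeasure μ] (M : SCRModel Ω μ) {c : ℝ≥0} (hc : 0 < c)
    {σmin w σmax : ℝ} (hσmin : 0 < σmin) (hw : 0 < w) (hσ : 0 < σmax)
    (hsub : M.SubGaussian c σmin) (hL : M.BoundedL1 w σmax) (k : Fin (M.K + 1)) {t : ℝ}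
    (ht : 0 ≤ t) :
    μ.real {ω | t ≤ |M.score (M.y ω) M.β k|} ≤ M.scoreTail c w σmax t := by
  have hp := M.p_pos_real
  obtain ⟨⟨Z, hZm, hyZ, hind, -, hmean, hvar, hZsub⟩, -⟩ := id hsub
  set B := matSqrt (M.cov M.β) with hB
  have hBs : B.IsSymm := matSqrt_isSymm _
  have hvar' : ∀ j, ∫ ω, Z ω j ^ 2 ∂μ = 1 := fun j => by
    rw [← hvar j, variance_of_integral_eq_zero
      (measurable_pi_iff.1 hZm j).aemeasurable (hmean j)]
  have htail := measureReal_abs_centeredForm_ge_le hc hZm hind hZsub hvar' (B * M.W k * B)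
    (isSymm_conj hBs (M.W_symm k)) (hL.matOneNorm_conj_le hw hσ (hL.1 k)) (mul_pos hw hσ) ht
  have htr : (B * M.W k * B).trace = frobInner (M.cov M.β) (M.W k) := by
    rw [Matrix.trace_mul_comm, ← Matrix.mul_assoc, hB, hsub.sqrt_mul_self hσmin,
      trace_mul_eq_frobInner _ _ (M.W_symm k)]
  have hae : {ω | t ≤ |M.score (M.y ω) M.β k|}
      ≤ᵐ[μ] {ω | Fintype.card (Fin M.p) * t ≤ |centeredForm (B * M.W k * B) (Z ω)|} := by
    filter_upwards [hyZ] with ω hω hle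
    have hle' : t ≤ |M.score (M.y ω) M.β k| := hle
    show Fintype.card (Fin M.p) * t ≤ |centeredForm (B * M.W k * B) (Z ω)|
    rw [score, hω, frobInner_vecMulVec_mulVec _ _ hBs, ← htr, abs_mul, abs_sub_comm,
      abs_of_pos (by positivity : 0 < 1 / (M.p : ℝ)), one_div, inv_mul_eq_div,
      le_div_iff₀ hp] at hle'
    rw [Fintype.card_fin, mul_comm]
    exact hle'
  calc _ ≤ μ.real {ω | Fintype.card (Fin M.p) * t ≤ |centeredForm (B * M.W k * B) (Z ω)|} :=
        ENNReal.toReal_mono (measure_ne_top _ _) (measure_mono_ae hae)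
    _ ≤ _ := htail
    _ = _ := by rw [scoreTail, quadRate, linRate, Fintype.card_fin, mul_pow w]

lemma score_tail_union_le [IsProbabilityMeasure μ] (M : SCRModel Ω μ) {c : ℝ≥0} (hc : 0 < c)
    {σmin w σmax : ℝ} (hσmin : 0 < σmin) (hw : 0 < w) (hσ : 0 < σmax)
    (hsub : M.SubGaussian c σmin) (hL : M.BoundedL1 w σmax) (T : Finset (Fin (M.K + 1))) {t : ℝ}
    (ht : 0 ≤ t) :
    μ.real {ω | ∃ k ∈ T, t ≤ |M.score (M.y ω) M.β k|} ≤ T.card * M.scoreTail c w σmax t := by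
  have h : {ω | ∃ k ∈ T, t ≤ |M.score (M.y ω) M.β k|}
      = ⋃ k ∈ T, {ω | t ≤ |M.score (M.y ω) M.β k|} := by
    ext ω; simp
  rw [h]
  refine (measureReal_biUnion_finset_le _ _).trans ?_
  rw [← nsmul_eq_mul]
  exact Finset.sum_le_card_nsmul _ _ _ fun k _ =>
    M.score_tail_le hc hσmin hw hσ hsub hL k ht

/-! ### The Lasso initializer -/

/-- Compare the Lasso objective at `b` and at `β`. Scores of size `lam0 / 2` consume half of the
penalty; the rest puts the error in the cone with constant 3, where (C5) applies. -/
lemma IsLasso.norm_sub_le {M : SCRModel Ω μ} {lam0 κ : ℝ} (hlam0 : 0 < lam0) (hκ : 0 < κ)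
    (hRE : M.RestrictedEigen κ) {v : Fin M.p → ℝ} {b : M.Coef} (hb : M.IsLasso lam0 v b)
    (hs : ∀ k, |M.score v M.β k| ≤ lam0 / 2) :
    ‖b - M.β‖ ≤ 3 * √((M.s : ℝ) + 1) * lam0 / κ := by
  have hp := M.p_pos_real
  set d : M.Coef := b - M.β with hd
  have h1 : M.Q v b + lam0 * ∑ k, |b k| ≤ M.Q v M.β + lam0 * ∑ k, |M.β k| := hb (Set.mem_univ _)
  rw [M.Q_eq v M.β b, ← hd] at h1
  set F := frobSq (M.cov d) with hF
  set dS := ∑ k ∈ M.S, |d k| with hdS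
  set dC := ∑ k ∈ M.Sᶜ, |d k| with hdC
  have hF0 : 0 ≤ 1 / (2 * (M.p : ℝ)) * F := by
    have := frobSq_nonneg (M.cov d); positivity
  have hcross : -(lam0 / 2 * (dS + dC)) ≤ ∑ k, (b k - M.β k) * M.score v M.β k := by
    rw [hdS, hdC, Finset.sum_add_sum_compl, Finset.mul_sum, ← Finset.sum_neg_distrib]
    refine Finset.sum_le_sum fun k _ => ?_
    have e := neg_abs_le ((b k - M.β k) * M.score v M.β k)
    rw [abs_mul] at e
    have e2 : d k = b k - M.β k := rfl
    rw [e2]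
    nlinarith [hs k, abs_nonneg (b k - M.β k)]
  have hpen : ∑ k, |M.β k| - ∑ k, |b k| ≤ dS - dC := by
    rw [← Finset.sum_sub_distrib, ← Finset.sum_add_sum_compl M.S, sub_eq_add_neg, hdS, hdC,
      ← Finset.sum_neg_distrib]
    refine add_le_add (Finset.sum_le_sum fun k _ => ?_) (Finset.sum_le_sum fun k hk => ?_)
    · have := abs_sub_abs_le_abs_sub (M.β k) (b k)
      rw [abs_sub_comm] at this
      exact this
    · have hβ := M.β_supported k (Finset.mem_compl.1 hk)
      have e2 : d k = b k - M.β k := rfl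
      rw [e2, hβ]; simp
  have hmain : 1 / (2 * (M.p : ℝ)) * F ≤ lam0 * (3 / 2 * dS - 1 / 2 * dC) := by
    nlinarith
  have hcone : dC ≤ 3 * dS := by
    by_contra hc
    push Not at hc
    nlinarith
  have hre : κ * ∑ k, d k ^ 2 ≤ 1 / (M.p : ℝ) * F := hRE d hcone
  set N := √(∑ k, d k ^ 2) with hN
  have hN0 : 0 ≤ N := Real.sqrt_nonneg _
  have hN2 : N ^ 2 = ∑ k, d k ^ 2 := Real.sq_sqrt (Finset.sum_nonneg fun _ _ => sq_nonneg _)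
  have hdSN : dS ≤ √((M.s : ℝ) + 1) * N := by
    rw [hN, ← Real.sqrt_mul (by positivity)]
    refine Real.le_sqrt_of_sq_le ?_
    have := sq_sum_le_card_mul_sum_sq (s := M.S) (f := fun k => |d k|)
    refine this.trans ?_
    rw [M.card_S]
    push_cast
    refine mul_le_mul_of_nonneg_left ?_ (by positivity)
    simp only [sq_abs]
    exact Finset.sum_le_sum_of_subset_of_nonneg (Finset.subset_univ _) fun _ _ _ => sq_nonneg _
  have hdC0 : 0 ≤ dC := Finset.sum_nonneg fun _ _ => abs_nonneg _
  have hκN : κ * N ^ 2 ≤ 3 * lam0 * (√((M.s : ℝ) + 1) * N) := by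
    have e : 1 / (M.p : ℝ) * F = 2 * (1 / (2 * (M.p : ℝ)) * F) := by field_simp
    rw [hN2]
    calc _ ≤ 2 * (1 / (2 * (M.p : ℝ)) * F) := by rw [← e]; exact hre
      _ ≤ 2 * (lam0 * (3 / 2 * dS - 1 / 2 * dC)) := by linarith
      _ ≤ 3 * lam0 * dS := by nlinarith
      _ ≤ _ := by gcongr
  have hNle : N ≤ 3 * √((M.s : ℝ) + 1) * lam0 / κ := by
    rw [le_div_iff₀ hκ]
    rcases hN0.eq_or_lt with h0 | h0
    · rw [← h0]; simp; positivity
    · refine le_of_mul_le_mul_left (?_ : N * (N * κ) ≤ N * (3 * √((M.s : ℝ) + 1) * lam0)) h0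
      nlinarith
  refine (pi_norm_le_iff_of_nonneg (by positivity)).2 fun k => ?_
  exact (abs_le_sqrt_sum_sq d k).trans hNle

lemma card_compl_S (M : SCRModel Ω μ) : ((M.Sᶜ).card : ℝ) = (M.K : ℝ) - M.s := by
  have h := M.s_le_K
  rw [Finset.card_compl, M.card_S, Fintype.card_fin, Nat.add_sub_add_right, Nat.cast_sub h]

/-! ### Explicit bounds for the three failure probabilities. -/

section Bounds

variable [IsProbabilityMeasure μ] (M : SCRModel Ω μ) {c : ℝ≥0}
  {a1 a2 γ lam lam0 τ σmin w σmax κ : ℝ}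

lemma delta0_le (hc : 0 < c) (ha2 : 0 < a2) (hlam0 : 0 ≤ lam0) (hσmin : 0 < σmin) (hw : 0 < w)
    (hσ : 0 < σmax) (hκ : 0 < κ) {lasso : Ω → M.Coef}
    (hlasso : ∀ ω, M.IsLasso lam0 (M.y ω) (lasso ω))
    (hlam : 3 * √((M.s : ℝ) + 1) * lam0 / (min 1 a2 * κ) ≤ lam)
    (hsub : M.SubGaussian c σmin) (hL : M.BoundedL1 w σmax) (hRE : M.RestrictedEigen κ) :
    M.delta0 lasso (min 1 a2) lam
      ≤ M.bound0 (quadRate c / 4) (linRate c / 2) w σmax lam0 := by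
  have ha0 : 0 < min 1 a2 := lt_min one_pos ha2
  -- For `lam0 = 0` the cone argument is not available, but the claimed bound `2 (K + 1)` exceeds
  -- one.
  rcases hlam0.eq_or_lt with h0 | h0
  · have h1 : M.delta0 lasso (min 1 a2) lam ≤ 1 := measureReal_le_one
    refine h1.trans ?_
    rw [bound0, ← h0]
    have : (0 : ℝ) ≤ M.K := Nat.cast_nonneg _
    simp
    linarith
  · have hsubset : {ω | min 1 a2 * lam < ‖lasso ω - M.β‖}
        ⊆ {ω | ∃ k ∈ Finset.univ, lam0 / 2 ≤ |M.score (M.y ω) M.β k|} := by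
      intro ω hω
      by_contra hc
      have hc' : ∀ k, |M.score (M.y ω) M.β k| ≤ lam0 / 2 := by
        intro k
        by_contra hk
        exact hc ⟨k, Finset.mem_univ k, (not_le.1 hk).le⟩
      have h2 := (hlasso ω).norm_sub_le h0 hκ hRE hc'
      have h3 : min 1 a2 * lam < ‖lasso ω - M.β‖ := hω
      have h4 := mul_le_mul_of_nonneg_left hlam ha0.le
      have h5 : min 1 a2 * (3 * √((M.s : ℝ) + 1) * lam0 / (min 1 a2 * κ))
          = 3 * √((M.s : ℝ) + 1) * lam0 / κ := by field_simp
      linarith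
    refine (measureReal_mono hsubset).trans
      ((M.score_tail_union_le hc hσmin hw hσ hsub hL _ (by positivity)).trans (le_of_eq ?_))
    rw [bound0, scoreTail, Finset.card_univ, Fintype.card_fin]
    push_cast
    rw [mul_left_comm, ← mul_assoc]
    congr 4 <;> ring

/-- An off-support score at the oracle is the one at `β` plus the response to the oracle error, and
each gets half of `a1 * lam`. The response is at most `w²` times the `ℓ₁` error, and `t2` solves `w²
(s + 1) t2 / τ = t1`. -/
lemma delta1_le (hc : 0 < c) (ha1 : 0 < a1) (hlam : 0 ≤ lam) (hτ : 0 < τ) (hσmin : 0 < σmin)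
    (hw : 0 < w) (hσ : 0 < σmax) (h : M.MinEigen τ) (hsub : M.SubGaussian c σmin)
    (hL : M.BoundedL1 w σmax) :
    M.delta1 a1 lam ≤ M.bound1 (quadRate c / 4) (linRate c / 2) (quadRate c / 4) (linRate c / 2)
      a1 w σmax τ lam := by
  have hs1 : (0 : ℝ) < (M.s : ℝ) + 1 := by positivity
  set t1 := a1 * lam / 2 with ht1
  set t2 := a1 * lam * τ / (2 * w ^ 2 * ((M.s : ℝ) + 1)) with ht2
  have ht1' : 0 ≤ t1 := by positivity
  have ht2' : 0 ≤ t2 := by positivity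
  have hb1 := M.score_tail_union_le hc hσmin hw hσ hsub hL M.Sᶜ ht1'
  have hb2 := M.score_tail_union_le hc hσmin hw hσ hsub hL M.S ht2'
  have e1 : M.scoreTail c w σmax t1 = 2 * Real.exp (-min
      (quadRate c / 4 * a1 ^ 2 * M.p * lam ^ 2 / (w ^ 2 * σmax ^ 2))
      (linRate c / 2 * a1 * M.p * lam / (w * σmax))) := by
    rw [scoreTail, ht1]; congr 4 <;> ring
  have e2 : M.scoreTail c w σmax t2 = 2 * Real.exp (-min
      (quadRate c / 4 * a1 ^ 2 * τ ^ 2 * M.p * lam ^ 2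
        / (w ^ 6 * σmax ^ 2 * ((M.s : ℝ) + 1) ^ 2))
      (linRate c / 2 * a1 * τ * M.p * lam / (w ^ 3 * σmax * ((M.s : ℝ) + 1)))) := by
    rw [scoreTail, ht2]
    congr 4 <;> field_simp
    ring
  rw [e1, M.card_compl_S] at hb1
  rw [e2, M.card_S] at hb2
  push_cast at hb2
  set x1 := Real.exp (-min
      (quadRate c / 4 * a1 ^ 2 * M.p * lam ^ 2 / (w ^ 2 * σmax ^ 2))
      (linRate c / 2 * a1 * M.p * lam / (w * σmax))) with hx1
  set x2 := Real.exp (-min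
      (quadRate c / 4 * a1 ^ 2 * τ ^ 2 * M.p * lam ^ 2
        / (w ^ 6 * σmax ^ 2 * ((M.s : ℝ) + 1) ^ 2))
      (linRate c / 2 * a1 * τ * M.p * lam / (w ^ 3 * σmax * ((M.s : ℝ) + 1)))) with hx2
  have hx2' : 0 < x2 := Real.exp_pos _
  have hbound : M.bound1 (quadRate c / 4) (linRate c / 2) (quadRate c / 4) (linRate c / 2)
      a1 w σmax τ lam = 2 * ((M.K : ℝ) - M.s) * x1
        + 2 * ((M.K : ℝ) - M.s) * ((M.s : ℝ) + 1) * x2 := rfl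
  rw [hbound]
  -- The union bound over `S` yields only the factor `s + 1`; the extra `K - s` in the second term
  -- is harmless once it is at least one. If it is zero, the event is empty.
  rcases M.s_le_K.eq_or_lt with hK | hK
  · have hcard : M.Sᶜ = ∅ := by
      have := M.card_compl_S
      rw [hK, sub_self] at this
      exact Finset.card_eq_zero.1 (by exact_mod_cast this)
    have hempty : {ω | ∃ k, k ∉ M.S ∧ a1 * lam ≤ |M.gradQ (M.y ω) (M.oracle (M.y ω)) k|} = ∅ := by
      ext ω
      simp only [Set.mem_ofPred_eq, Set.mem_empty_iff_false, iff_false, not_exists, not_and]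
      intro k hk
      have : k ∈ M.Sᶜ := Finset.mem_compl.2 hk
      rw [hcard] at this
      simp at this
    rw [delta1, hempty, hK]; simp
  · have hK1 : (1 : ℝ) ≤ (M.K : ℝ) - M.s := by
      have : ((M.s + 1 : ℕ) : ℝ) ≤ M.K := by exact_mod_cast hK
      push_cast at this; linarith
    have hsubset : {ω | ∃ k, k ∉ M.S ∧ a1 * lam ≤ |M.gradQ (M.y ω) (M.oracle (M.y ω)) k|}
        ⊆ {ω | ∃ k ∈ M.Sᶜ, t1 ≤ |M.score (M.y ω) M.β k|}
          ∪ {ω | ∃ k ∈ M.S, t2 ≤ |M.score (M.y ω) M.β k|} := by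
      rintro ω ⟨k, hk, hle⟩
      by_contra hcon
      rw [Set.mem_union, not_or] at hcon
      obtain ⟨n1, n2⟩ := hcon
      have n1' : |M.score (M.y ω) M.β k| < t1 := by
        by_contra hc'
        exact n1 ⟨k, Finset.mem_compl.2 hk, not_lt.1 hc'⟩
      have n2' : ∀ l ∈ M.S, |M.score (M.y ω) M.β l| ≤ t2 := by
        intro l hl
        by_contra hc'
        exact n2 ⟨l, hl, (not_le.1 hc').le⟩
      set v := M.y ω
      set d : M.Coef := M.oracle v - M.β with hd
      have hds : d ∈ M.supported := M.supported_sub (h.oracle_supported hτ v) M.β_supported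
      have hN := h.norm_oracle_sub_le hτ v ht2' n2'
      have hsc := M.score_add v M.β d k
      rw [hd, add_sub_cancel, ← hd] at hsc
      have hinner : |1 / (M.p : ℝ) * frobInner (M.cov d) (M.W k)| ≤ t1 := by
        have hp := M.p_pos_real
        have hWW : ∀ l, |frobInner (M.W l) (M.W k)| ≤ M.p * w ^ 2 := by
          intro l
          refine (abs_frobInner_le _ _).trans ?_
          rw [Fintype.card_fin, sq]
          exact mul_le_mul_of_nonneg_left
            (mul_le_mul (hL.1 l) (hL.1 k) (matOneNorm_nonneg _) hw.le) hp.le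
        have hl1 : ∑ l ∈ M.S, |d l| ≤ ((M.s : ℝ) + 1) * t2 / τ := by
          have hcs := sq_sum_le_card_mul_sum_sq (s := M.S) (f := fun k => |d k|)
          rw [M.card_S] at hcs
          simp only [sq_abs] at hcs
          push_cast at hcs
          have hS2 : ∑ l ∈ M.S, d l ^ 2 ≤ ∑ l, d l ^ 2 :=
            Finset.sum_le_sum_of_subset_of_nonneg (Finset.subset_univ _) fun _ _ _ => sq_nonneg _
          have h6 : ∑ l ∈ M.S, |d l| ≤ √((M.s : ℝ) + 1) * √(∑ l, d l ^ 2) := by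
            rw [← Real.sqrt_mul hs1.le]
            refine Real.le_sqrt_of_sq_le (hcs.trans ?_)
            gcongr
          refine h6.trans ?_
          calc √((M.s : ℝ) + 1) * √(∑ l, d l ^ 2)
              ≤ √((M.s : ℝ) + 1) * (√((M.s : ℝ) + 1) * t2 / τ) := by
                refine mul_le_mul_of_nonneg_left ?_ (Real.sqrt_nonneg _)
                exact hN
            _ = _ := by
                rw [← mul_div_assoc, ← mul_assoc, Real.mul_self_sqrt hs1.le]
        have hfi : |frobInner (M.cov d) (M.W k)| ≤ (∑ l ∈ M.S, |d l|) * (M.p * w ^ 2) := by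
          rw [frobInner_cov, M.sum_eq_sum_S hds (fun l x => x * frobInner (M.W l) (M.W k))
            (by simp), Finset.sum_mul]
          refine (Finset.abs_sum_le_sum_abs _ _).trans (Finset.sum_le_sum fun l _ => ?_)
          rw [abs_mul]
          exact mul_le_mul_of_nonneg_left (hWW l) (abs_nonneg _)
        rw [abs_mul, abs_of_pos (by positivity : 0 < 1 / (M.p : ℝ))]
        calc _ ≤ 1 / (M.p : ℝ) * ((((M.s : ℝ) + 1) * t2 / τ) * (M.p * w ^ 2)) := by
              gcongr
              exact hfi.trans (mul_le_mul_of_nonneg_right hl1 (by positivity))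
          _ = t1 := by rw [ht1, ht2]; field_simp
      rw [gradQ_eq_score] at hle
      have habs := abs_add_le (M.score v M.β k) (1 / (M.p : ℝ) * frobInner (M.cov d) (M.W k))
      rw [← hsc] at habs
      have : a1 * lam = t1 + t1 := by rw [ht1]; ring
      linarith
    have hd1 : M.delta1 a1 lam ≤ _ :=
      (measureReal_mono hsubset).trans (measureReal_union_le _ _)
    have hx : ((M.s : ℝ) + 1) * (2 * x2) ≤ 2 * ((M.K : ℝ) - M.s) * ((M.s : ℝ) + 1) * x2 := by
      have : 0 ≤ ((M.s : ℝ) + 1) * x2 := by positivity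
      nlinarith
    linarith

lemma delta2_le (hc : 0 < c) (hlam : 0 ≤ lam) (hτ : 0 < τ) (hσmin : 0 < σmin)
    (hw : 0 < w) (hσ : 0 < σmax) (hsig : M.MinSignal γ lam) (h : M.MinEigen τ)
    (hsub : M.SubGaussian c σmin) (hL : M.BoundedL1 w σmax) :
    M.delta2 γ lam ≤ M.bound2 (quadRate c) (linRate c) γ w σmax τ lam := by
  have hs1 : (0 : ℝ) < (M.s : ℝ) + 1 := by positivity
  set u := minAbs M.S M.β - γ * lam with hu
  have hu0 : 0 ≤ u := by
    have : (γ + 1) * lam < minAbs M.S M.β := hsig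
    rw [hu]; nlinarith
  -- Chosen so that scores up to `t` on `S` give an oracle error of at most the margin `u`.
  set t := u * τ / √((M.s : ℝ) + 1) with ht
  have ht0 : 0 ≤ t := by positivity
  have hsubset : {ω | minAbs M.S (M.oracle (M.y ω)) < γ * lam}
      ⊆ {ω | ∃ k ∈ M.S, t ≤ |M.score (M.y ω) M.β k|} := by
    intro ω hω
    have hω' : minAbs M.S (M.oracle (M.y ω)) < γ * lam := hω
    by_contra hcon
    have n : ∀ l ∈ M.S, |M.score (M.y ω) M.β l| ≤ t := by
      intro l hl
      by_contra hc'
      exact hcon ⟨l, hl, (not_le.1 hc').le⟩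
    have hN := h.norm_oracle_sub_le hτ (M.y ω) ht0 n
    obtain ⟨k, hk, hkeq⟩ := exists_minAbs_eq M.S_nonempty (M.oracle (M.y ω))
    have h1 := abs_le_sqrt_sum_sq (fun k => M.oracle (M.y ω) k - M.β k) k
    have h2 := abs_sub_abs_le_abs_sub (M.β k) (M.oracle (M.y ω) k)
    rw [abs_sub_comm] at h2
    have h3 := minAbs_le M.β hk
    have h4 : √((M.s : ℝ) + 1) * t / τ = u := by
      have := Real.sqrt_pos.2 hs1
      rw [ht]; field_simp
    linarith
  refine (measureReal_mono hsubset).trans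
    ((M.score_tail_union_le hc hσmin hw hσ hsub hL _ ht0).trans (le_of_eq ?_))
  have h5 : √((M.s : ℝ) + 1) ^ 2 = (M.s : ℝ) + 1 := Real.sq_sqrt hs1.le
  rw [bound2, scoreTail, M.card_S, ← hu, ht, div_pow, h5]
  push_cast
  rw [mul_left_comm, ← mul_assoc]
  have h6 := Real.sqrt_pos.2 hs1
  congr 4
  · field_simp
  · field_simp

end Bounds

end SCRModel

namespace SCRModel

/-! ### Vanishing of the failure probabilities. -/

section Asymptotics

variable {Ω : Type*} [MeasurableSpace Ω] {μ : Measure Ω}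

lemma delta0_nonneg (M : SCRModel Ω μ) (init : Ω → M.Coef) (a0 lam : ℝ) :
    0 ≤ M.delta0 init a0 lam := measureReal_nonneg

lemma delta1_nonneg (M : SCRModel Ω μ) (a1 lam : ℝ) : 0 ≤ M.delta1 a1 lam := measureReal_nonneg

lemma delta2_nonneg (M : SCRModel Ω μ) (γ lam : ℝ) : 0 ≤ M.delta2 γ lam := measureReal_nonneg

/-- The restricted eigenvalue condition at the true coefficients bounds the signal. -/
lemma minAbs_β_le (M : SCRModel Ω μ) {c : ℝ≥0} {σmin w σmax κ : ℝ} (hσmin : 0 < σmin)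
    (hσ : 0 < σmax) (hκ : 0 < κ) (hsub : M.SubGaussian c σmin) (hL : M.BoundedL1 w σmax)
    (hRE : M.RestrictedEigen κ) : minAbs M.S M.β ≤ σmax / √κ := by
  have hp := M.p_pos_real
  obtain ⟨k, hk⟩ := M.S_nonempty
  have hnorm : matOneNorm (M.cov M.β) ≤ σmax := by
    rw [← hsub.sqrt_mul_self hσmin, ← Real.mul_self_sqrt hσ.le]
    exact (matOneNorm_mul_le _ _).trans
      (mul_le_mul hL.2 hL.2 (matOneNorm_nonneg _) (Real.sqrt_nonneg _))
  have hF : frobSq (M.cov M.β) ≤ M.p * σmax ^ 2 := by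
    refine (frobSq_le_matOneNorm_sq _).trans ?_
    rw [Fintype.card_fin]
    exact mul_le_mul_of_nonneg_left (pow_le_pow_left₀ (matOneNorm_nonneg _) hnorm 2) hp.le
  have hcone : ∑ k ∈ M.Sᶜ, |M.β k| ≤ 3 * ∑ k ∈ M.S, |M.β k| := by
    rw [Finset.sum_eq_zero fun k hk => by rw [M.β_supported k (Finset.mem_compl.1 hk), abs_zero]]
    positivity
  have h1 : κ * ∑ k, M.β k ^ 2 ≤ 1 / (M.p : ℝ) * frobSq (M.cov M.β) := hRE M.β hcone
  have h2 : 1 / (M.p : ℝ) * frobSq (M.cov M.β) ≤ σmax ^ 2 := by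
    rw [one_div, inv_mul_le_iff₀ hp]; exact hF
  have h3 : M.β k ^ 2 ≤ ∑ k, M.β k ^ 2 :=
    Finset.single_le_sum (f := fun k => M.β k ^ 2) (fun _ _ => sq_nonneg _) (Finset.mem_univ k)
  refine (minAbs_le M.β hk).trans ?_
  rw [le_div_iff₀ (Real.sqrt_pos.2 hκ)]
  refine le_of_sq_le_sq ?_ hσ.le
  rw [mul_pow, sq_abs, Real.sq_sqrt hκ.le]
  nlinarith

/-- With `x = p λ₀² / S`, all the powers of `λ₀`, `λ` and `u` in the exponents dominate multiples
of `x`, provided that `λ₀` is bounded by `Λ`. -/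
lemma rate_bounds {p S lam0 lam u r Λ : ℝ} (hp : 0 < p) (hS : 1 ≤ S) (hl0 : 0 ≤ lam0)
    (hr0 : 0 < r) (hΛ0 : 0 < Λ) (hlΛ : lam0 ≤ Λ) (hlam' : r * √S * lam0 ≤ lam) (hu : lam ≤ u) :
    p * lam0 ^ 2 / S ≤ p * lam0 ^ 2 ∧ p * lam0 ^ 2 / S / Λ ≤ p * lam0 ∧
    r ^ 2 * (p * lam0 ^ 2 / S) ≤ p * lam ^ 2 ∧
    r * (p * lam0 ^ 2 / S / Λ) ≤ p * lam ∧
    r ^ 2 * (p * lam0 ^ 2 / S) ≤ p * lam ^ 2 / S ^ 2 ∧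
    r * (p * lam0 ^ 2 / S / Λ) ≤ p * lam / S ∧
    r ^ 2 * (p * lam0 ^ 2 / S) ≤ p * u ^ 2 / S ∧
    r * (p * lam0 ^ 2 / S / Λ) ≤ p * u / √S := by
  have hS0 : 0 < S := by linarith
  have hsq : √S ^ 2 = S := Real.sq_sqrt hS0.le
  have hs1 : 1 ≤ √S := Real.one_le_sqrt.2 hS
  have hs0 : 0 < √S := by linarith
  have hrl : r * lam0 ≤ lam := by
    refine le_trans ?_ hlam'
    have : 0 ≤ r * lam0 := by positivity
    nlinarith
  have hlam0 : 0 ≤ lam := le_trans (by positivity) hrl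
  obtain ⟨x, hx⟩ : ∃ x, x = p * lam0 ^ 2 / S := ⟨_, rfl⟩
  rw [← hx]
  have hx0 : 0 ≤ x := by rw [hx]; positivity
  have hxle : x ≤ p * lam0 ^ 2 := by rw [hx]; exact div_le_self (by positivity) hS
  have hlin : p * lam0 ^ 2 / Λ ≤ p * lam0 := by
    rw [div_le_iff₀ hΛ0]
    calc p * lam0 ^ 2 = p * lam0 * lam0 := by ring
      _ ≤ _ := by gcongr
  have hxlin : x / Λ ≤ p * lam0 := le_trans (by gcongr) hlin
  have hlamsq : r ^ 2 * S * lam0 ^ 2 ≤ lam ^ 2 := by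
    calc _ = (r * √S * lam0) ^ 2 := by rw [mul_pow, mul_pow, hsq]
      _ ≤ _ := pow_le_pow_left₀ (by positivity) hlam' 2
  have hxS : x * S = p * lam0 ^ 2 := by rw [hx]; field_simp
  -- The most demanding quadratic exponent: the factor `√S` in the lower bound for `lam` cancels one
  -- of the two powers of `S`.
  have hq2 : r ^ 2 * x ≤ p * lam ^ 2 / S ^ 2 := by
    rw [le_div_iff₀ (by positivity)]
    calc r ^ 2 * x * S ^ 2 = r ^ 2 * (x * S) * S := by ring
      _ = p * (r ^ 2 * S * lam0 ^ 2) := by rw [hxS]; ring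
      _ ≤ _ := by gcongr
  have hq : r ^ 2 * x ≤ p * lam ^ 2 / S := by
    refine hq2.trans ?_
    gcongr
    nlinarith
  refine ⟨hxle, hxlin, hq.trans (div_le_self (by positivity) hS), ?_, hq2, ?_, ?_, ?_⟩
  · calc _ ≤ r * (p * lam0) := by gcongr
      _ = p * (r * lam0) := by ring
      _ ≤ _ := by gcongr
  · rw [le_div_iff₀ hS0]
    calc r * (x / Λ) * S = r * (p * lam0 ^ 2 / Λ) := by rw [← hxS]; ring
      _ ≤ r * (p * lam0) := by gcongr
      _ = p * (r * lam0) := by ring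
      _ ≤ _ := by gcongr
  · refine hq.trans ?_
    gcongr
  · rw [le_div_iff₀ hs0]
    calc r * (x / Λ) * √S ≤ r * (p * lam0) * √S := by gcongr
      _ = p * (r * √S * lam0) := by ring
      _ ≤ _ := by gcongr; linarith

/-- A rate that is a common lower bound of all the exponents, for constants `A` and `B` in the
quadratic and the linear regimes. -/
lemma exists_common_rate {A B a1 a0 γ τ w σmax κ : ℝ} (hA : 0 < A) (hB : 0 < B) (ha1 : 0 < a1)
    (ha0 : 0 < a0) (hγ : 0 < γ) (hτ : 0 < τ) (hw : 0 < w) (hσ : 0 < σmax) (hκ : 0 < κ) :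
    ∃ b > 0, ∀ (p S lam0 lam m : ℝ), 0 < p → 1 ≤ S → 0 ≤ lam0 →
      3 * √S * lam0 / (a0 * κ) ≤ lam → (γ + 1) * lam < m → m ≤ σmax / √κ →
      b * (p * lam0 ^ 2 / S) ≤ A * p * lam0 ^ 2 / (w ^ 2 * σmax ^ 2) ∧
      b * (p * lam0 ^ 2 / S) ≤ B * p * lam0 / (w * σmax) ∧
      b * (p * lam0 ^ 2 / S) ≤ A * a1 ^ 2 * p * lam ^ 2 / (w ^ 2 * σmax ^ 2) ∧
      b * (p * lam0 ^ 2 / S) ≤ B * a1 * p * lam / (w * σmax) ∧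
      b * (p * lam0 ^ 2 / S)
        ≤ A * a1 ^ 2 * τ ^ 2 * p * lam ^ 2 / (w ^ 6 * σmax ^ 2 * S ^ 2) ∧
      b * (p * lam0 ^ 2 / S) ≤ B * a1 * τ * p * lam / (w ^ 3 * σmax * S) ∧
      b * (p * lam0 ^ 2 / S)
        ≤ A * τ ^ 2 * p * (m - γ * lam) ^ 2 / (w ^ 2 * σmax ^ 2 * S) ∧
      b * (p * lam0 ^ 2 / S) ≤ B * τ * p * (m - γ * lam) / (w * σmax * √S) := by
  obtain ⟨r, hr⟩ : ∃ r, r = 3 / (a0 * κ) := ⟨_, rfl⟩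
  have hr0 : 0 < r := by rw [hr]; positivity
  have hκ' := Real.sqrt_pos.2 hκ
  -- An a priori bound on `lam0`, from `r * lam0 ≤ lam ≤ m ≤ σmax / √κ`. It does not depend on the
  -- model, so neither does `b`.
  obtain ⟨Λ, hΛ⟩ : ∃ Λ, Λ = σmax / √κ / r := ⟨_, rfl⟩
  have hΛ0 : 0 < Λ := by rw [hΛ]; positivity
  have hmin : ∃ b > 0, b ≤ A / (w ^ 2 * σmax ^ 2) ∧ b ≤ B / (w * σmax) / Λ ∧
      b ≤ A * a1 ^ 2 * r ^ 2 / (w ^ 2 * σmax ^ 2) ∧ b ≤ B * a1 * r / (w * σmax) / Λ ∧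
      b ≤ A * a1 ^ 2 * τ ^ 2 * r ^ 2 / (w ^ 6 * σmax ^ 2) ∧
      b ≤ B * a1 * τ * r / (w ^ 3 * σmax) / Λ ∧
      b ≤ A * τ ^ 2 * r ^ 2 / (w ^ 2 * σmax ^ 2) ∧ b ≤ B * τ * r / (w * σmax) / Λ := by
    have hex : ∀ {x y : ℝ}, 0 < x → 0 < y → ∃ z > 0, z ≤ x ∧ z ≤ y := fun hx hy =>
      ⟨_, lt_min hx hy, min_le_left _ _, min_le_right _ _⟩
    have h1 : 0 < A / (w ^ 2 * σmax ^ 2) := by positivity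
    have h2 : 0 < B / (w * σmax) / Λ := by positivity
    have h3 : 0 < A * a1 ^ 2 * r ^ 2 / (w ^ 2 * σmax ^ 2) := by positivity
    have h4 : 0 < B * a1 * r / (w * σmax) / Λ := by positivity
    have h5 : 0 < A * a1 ^ 2 * τ ^ 2 * r ^ 2 / (w ^ 6 * σmax ^ 2) := by positivity
    have h6 : 0 < B * a1 * τ * r / (w ^ 3 * σmax) / Λ := by positivity
    have h7 : 0 < A * τ ^ 2 * r ^ 2 / (w ^ 2 * σmax ^ 2) := by positivity
    have h8 : 0 < B * τ * r / (w * σmax) / Λ := by positivity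
    obtain ⟨z1, p1, u1, v1⟩ := hex h1 h2
    obtain ⟨z2, p2, u2, v2⟩ := hex h3 h4
    obtain ⟨z3, p3, u3, v3⟩ := hex h5 h6
    obtain ⟨z4, p4, u4, v4⟩ := hex h7 h8
    obtain ⟨z5, p5, u5, v5⟩ := hex p1 p2
    obtain ⟨z6, p6, u6, v6⟩ := hex p3 p4
    obtain ⟨z, pz, u, v⟩ := hex p5 p6
    exact ⟨z, pz, (u.trans u5).trans u1, (u.trans u5).trans v1, (u.trans v5).trans u2,
      (u.trans v5).trans v2, (v.trans u6).trans u3, (v.trans u6).trans v3, (v.trans v6).trans u4,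
      (v.trans v6).trans v4⟩
  obtain ⟨b, hb0, c1, c2, c3, c4, c5, c6, c7, c8⟩ := hmin
  refine ⟨b, hb0, ?_⟩
  intro p S lam0 lam m hp hS hl0 hlam hm hmΛ
  have hS0 : 0 < S := by linarith
  have hs1 : 1 ≤ √S := Real.one_le_sqrt.2 hS
  have hlam' : r * √S * lam0 ≤ lam := by
    refine le_trans (le_of_eq ?_) hlam
    rw [hr]; ring
  have hrl : r * lam0 ≤ lam := by
    refine le_trans ?_ hlam'
    have : 0 ≤ r * lam0 := by positivity
    nlinarith
  have hlam0 : 0 ≤ lam := le_trans (by positivity) hrl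
  have hlΛ : lam0 ≤ Λ := by
    rw [hΛ, le_div_iff₀ hr0]
    nlinarith [mul_nonneg hγ.le hlam0]
  obtain ⟨f1, f2, f3, f4, f5, f6, f7, f8⟩ :=
    rate_bounds hp hS hl0 hr0 hΛ0 hlΛ hlam' (by linarith : lam ≤ m - γ * lam)
  generalize m - γ * lam = u at *
  have hx0 : 0 ≤ p * lam0 ^ 2 / S := by positivity
  generalize p * lam0 ^ 2 / S = x at *
  refine ⟨?_, ?_, ?_, ?_, ?_, ?_, ?_, ?_⟩
  · refine (mul_le_mul_of_nonneg_right c1 hx0).trans ?_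
    calc A / (w ^ 2 * σmax ^ 2) * x ≤ A / (w ^ 2 * σmax ^ 2) * (p * lam0 ^ 2) := by gcongr
      _ = _ := by ring
  · refine (mul_le_mul_of_nonneg_right c2 hx0).trans ?_
    calc B / (w * σmax) / Λ * x = B / (w * σmax) * (x / Λ) := by ring
      _ ≤ B / (w * σmax) * (p * lam0) := by gcongr
      _ = _ := by ring
  · refine (mul_le_mul_of_nonneg_right c3 hx0).trans ?_
    calc A * a1 ^ 2 * r ^ 2 / (w ^ 2 * σmax ^ 2) * x
        = A * a1 ^ 2 / (w ^ 2 * σmax ^ 2) * (r ^ 2 * x) := by ring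
      _ ≤ A * a1 ^ 2 / (w ^ 2 * σmax ^ 2) * (p * lam ^ 2) := by gcongr
      _ = _ := by ring
  · refine (mul_le_mul_of_nonneg_right c4 hx0).trans ?_
    calc B * a1 * r / (w * σmax) / Λ * x = B * a1 / (w * σmax) * (r * (x / Λ)) := by ring
      _ ≤ B * a1 / (w * σmax) * (p * lam) := by gcongr
      _ = _ := by ring
  · refine (mul_le_mul_of_nonneg_right c5 hx0).trans ?_
    calc A * a1 ^ 2 * τ ^ 2 * r ^ 2 / (w ^ 6 * σmax ^ 2) * x
        = A * a1 ^ 2 * τ ^ 2 / (w ^ 6 * σmax ^ 2) * (r ^ 2 * x) := by ring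
      _ ≤ A * a1 ^ 2 * τ ^ 2 / (w ^ 6 * σmax ^ 2) * (p * lam ^ 2 / S ^ 2) := by gcongr
      _ = _ := by rw [div_mul_div_comm]; ring
  · refine (mul_le_mul_of_nonneg_right c6 hx0).trans ?_
    calc B * a1 * τ * r / (w ^ 3 * σmax) / Λ * x
        = B * a1 * τ / (w ^ 3 * σmax) * (r * (x / Λ)) := by ring
      _ ≤ B * a1 * τ / (w ^ 3 * σmax) * (p * lam / S) := by gcongr
      _ = _ := by rw [div_mul_div_comm]; ring
  · refine (mul_le_mul_of_nonneg_right c7 hx0).trans ?_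
    calc A * τ ^ 2 * r ^ 2 / (w ^ 2 * σmax ^ 2) * x
        = A * τ ^ 2 / (w ^ 2 * σmax ^ 2) * (r ^ 2 * x) := by ring
      _ ≤ A * τ ^ 2 / (w ^ 2 * σmax ^ 2) * (p * u ^ 2 / S) := by gcongr
      _ = _ := by rw [div_mul_div_comm]; ring
  · refine (mul_le_mul_of_nonneg_right c8 hx0).trans ?_
    calc B * τ * r / (w * σmax) / Λ * x = B * τ / (w * σmax) * (r * (x / Λ)) := by ring
      _ ≤ B * τ / (w * σmax) * (p * u / √S) := by gcongr
      _ = _ := by rw [div_mul_div_comm]; ring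

lemma delta_sum_le [IsProbabilityMeasure μ] (M : SCRModel Ω μ) {c : ℝ≥0}
    {a1 a2 γ lam lam0 τ σmin w σmax κ b : ℝ}
    {lasso : Ω → M.Coef} (hc : 0 < c) (ha1 : 0 < a1) (ha2 : 0 < a2) (hlam0 : 0 ≤ lam0)
    (hτ : 0 < τ) (hσmin : 0 < σmin) (hw : 0 < w) (hσ : 0 < σmax) (hκ : 0 < κ)
    (hlasso : ∀ ω, M.IsLasso lam0 (M.y ω) (lasso ω))
    (hlam : 3 * √((M.s : ℝ) + 1) * lam0 / (min 1 a2 * κ) ≤ lam) (hsig : M.MinSignal γ lam)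
    (h : M.MinEigen τ) (hsub : M.SubGaussian c σmin) (hL : M.BoundedL1 w σmax)
    (hRE : M.RestrictedEigen κ)
    (hb : ∀ (p S lam0 lam m : ℝ), 0 < p → 1 ≤ S → 0 ≤ lam0 →
      3 * √S * lam0 / (min 1 a2 * κ) ≤ lam → (γ + 1) * lam < m → m ≤ σmax / √κ →
      b * (p * lam0 ^ 2 / S) ≤ quadRate c / 4 * p * lam0 ^ 2 / (w ^ 2 * σmax ^ 2) ∧
      b * (p * lam0 ^ 2 / S) ≤ linRate c / 2 * p * lam0 / (w * σmax) ∧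
      b * (p * lam0 ^ 2 / S) ≤ quadRate c / 4 * a1 ^ 2 * p * lam ^ 2 / (w ^ 2 * σmax ^ 2) ∧
      b * (p * lam0 ^ 2 / S) ≤ linRate c / 2 * a1 * p * lam / (w * σmax) ∧
      b * (p * lam0 ^ 2 / S)
        ≤ quadRate c / 4 * a1 ^ 2 * τ ^ 2 * p * lam ^ 2 / (w ^ 6 * σmax ^ 2 * S ^ 2) ∧
      b * (p * lam0 ^ 2 / S) ≤ linRate c / 2 * a1 * τ * p * lam / (w ^ 3 * σmax * S) ∧
      b * (p * lam0 ^ 2 / S)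
        ≤ quadRate c / 4 * τ ^ 2 * p * (m - γ * lam) ^ 2 / (w ^ 2 * σmax ^ 2 * S) ∧
      b * (p * lam0 ^ 2 / S) ≤ linRate c / 2 * τ * p * (m - γ * lam) / (w * σmax * √S)) :
    M.delta0 lasso (min 1 a2) lam + M.delta1 a1 lam + M.delta2 γ lam
      ≤ 8 * ((M.K : ℝ) + 1) ^ 2 * Real.exp (-(b * (M.p * lam0 ^ 2 / ((M.s : ℝ) + 1)))) := by
  have hp := M.p_pos_real
  have hc' : (0 : ℝ) < c := hc
  have hA := quadRate_pos hc'
  have hB := linRate_pos hc'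
  have ha0 : 0 < min 1 a2 := lt_min one_pos ha2
  have hs0 : (0 : ℝ) ≤ M.s := Nat.cast_nonneg _
  have hsK : (M.s : ℝ) ≤ M.K := by exact_mod_cast M.s_le_K
  have hlam_nonneg : 0 ≤ lam := le_trans (by positivity) hlam
  have hsig' : (γ + 1) * lam < minAbs M.S M.β := hsig
  have hu : 0 ≤ minAbs M.S M.β - γ * lam := by nlinarith
  obtain ⟨e1, e2, e3, e4, e5, e6, e7, e8⟩ := hb M.p ((M.s : ℝ) + 1) lam0 lam (minAbs M.S M.β) hp
    (by linarith) hlam0 hlam hsig' (M.minAbs_β_le hσmin hσ hκ hsub hL hRE)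
  set x := b * (M.p * lam0 ^ 2 / ((M.s : ℝ) + 1)) with hx
  have hexp : ∀ {u v : ℝ}, x ≤ u → x ≤ v → Real.exp (-min u v) ≤ Real.exp (-x) := fun h1 h2 =>
    Real.exp_le_exp.2 (neg_le_neg (le_min h1 h2))
  have d0 := M.delta0_le hc ha2 hlam0 hσmin hw hσ hκ hlasso hlam hsub hL hRE
  have d1 := M.delta1_le hc ha1 hlam_nonneg hτ hσmin hw hσ h hsub hL
  have d2 := M.delta2_le hc hlam_nonneg hτ hσmin hw hσ hsig h hsub hL
  have b0 : M.bound0 (quadRate c / 4) (linRate c / 2) w σmax lam0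
      ≤ 2 * ((M.K : ℝ) + 1) * Real.exp (-x) :=
    mul_le_mul_of_nonneg_left (hexp e1 e2) (by positivity)
  have hKs : 0 ≤ (M.K : ℝ) - M.s := by linarith
  have b1 : M.bound1 (quadRate c / 4) (linRate c / 2) (quadRate c / 4) (linRate c / 2)
      a1 w σmax τ lam ≤ 2 * ((M.K : ℝ) - M.s) * Real.exp (-x)
        + 2 * ((M.K : ℝ) - M.s) * ((M.s : ℝ) + 1) * Real.exp (-x) :=
    add_le_add (mul_le_mul_of_nonneg_left (hexp e3 e4) (by positivity))
      (mul_le_mul_of_nonneg_left (hexp e5 e6) (by positivity))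
  -- The bound for `delta2` has the larger constants `quadRate c` and `linRate c`, so the common
  -- rate is sufficient here too.
  have e7' : x ≤ quadRate c * τ ^ 2 * M.p * (minAbs M.S M.β - γ * lam) ^ 2
      / (w ^ 2 * σmax ^ 2 * ((M.s : ℝ) + 1)) := by
    refine e7.trans ?_
    gcongr
    linarith
  have e8' : x ≤ linRate c * τ * M.p * (minAbs M.S M.β - γ * lam)
      / (w * σmax * √((M.s : ℝ) + 1)) := by
    refine e8.trans ?_
    gcongr
    linarith
  have b2 : M.bound2 (quadRate c) (linRate c) γ w σmax τ lam
      ≤ 2 * ((M.s : ℝ) + 1) * Real.exp (-x) :=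
    mul_le_mul_of_nonneg_left (hexp e7' e8') (by positivity)
  have hE := Real.exp_pos (-x)
  have hpoly : 2 * ((M.K : ℝ) + 1) + (2 * ((M.K : ℝ) - M.s)
      + 2 * ((M.K : ℝ) - M.s) * ((M.s : ℝ) + 1)) + 2 * ((M.s : ℝ) + 1)
      ≤ 8 * ((M.K : ℝ) + 1) ^ 2 := by nlinarith
  calc _ ≤ (2 * ((M.K : ℝ) + 1) + (2 * ((M.K : ℝ) - M.s)
      + 2 * ((M.K : ℝ) - M.s) * ((M.s : ℝ) + 1)) + 2 * ((M.s : ℝ) + 1)) * Real.exp (-x) := by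
        linarith
    _ ≤ _ := mul_le_mul_of_nonneg_right hpoly hE.le

end Asymptotics

/-- With `m = max K 2`, the prefactor satisfies `(K + 1)² ≤ m⁴ = exp (4 log m)`, while `s + 1 ≤ 2
max s 1` makes the exponent at least `(b / 2) R log m`, where `R` is the diverging ratio. -/
theorem tendsto_delta_sum {Ω : ℕ → Type*} [∀ n, MeasurableSpace (Ω n)] {μ : ∀ n, Measure (Ω n)}
    [∀ n, IsProbabilityMeasure (μ n)] (M : ∀ n, SCRModel (Ω n) (μ n))
    {c : ℝ≥0} {a1 a2 γ τ σmin w σmax κ : ℝ} {lam lam0 : ℕ → ℝ} {lasso : ∀ n, Ω n → (M n).Coef}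
    (hc : 0 < c) (ha1 : 0 < a1) (ha2 : 0 < a2) (hγ : a2 < γ) (hτ : 0 < τ) (hσmin : 0 < σmin)
    (hw : 0 < w) (hσ : 0 < σmax) (hκ : 0 < κ) (hlam0 : ∀ n, 0 ≤ lam0 n)
    (hlasso : ∀ n ω, (M n).IsLasso (lam0 n) ((M n).y ω) (lasso n ω))
    (hlam : ∀ n, 3 * √(((M n).s : ℝ) + 1) * lam0 n / (min 1 a2 * κ) ≤ lam n)
    (hsig : ∀ n, (M n).MinSignal γ (lam n)) (h : ∀ n, (M n).MinEigen τ)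
    (hsub : ∀ n, (M n).SubGaussian c σmin) (hL : ∀ n, (M n).BoundedL1 w σmax)
    (hRE : ∀ n, (M n).RestrictedEigen κ)
    (hrate : Tendsto (fun n => ((M n).p : ℝ) * lam0 n ^ 2
      / (max ((M n).s : ℝ) 1 * Real.log (max ((M n).K : ℝ) 2))) atTop atTop) :
    Tendsto (fun n => (M n).delta0 (lasso n) (min 1 a2) (lam n)
      + (M n).delta1 a1 (lam n) + (M n).delta2 γ (lam n)) atTop (𝓝 0) := by
  have hc' : (0 : ℝ) < c := hc
  obtain ⟨b, hb0, hb⟩ := exists_common_rate (A := quadRate c / 4) (B := linRate c / 2)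
    (a1 := a1) (a0 := min 1 a2) (γ := γ) (τ := τ) (w := w) (σmax := σmax) (κ := κ)
    (div_pos (quadRate_pos hc') (by norm_num)) (div_pos (linRate_pos hc') (by norm_num)) ha1
    (lt_min one_pos ha2) (ha2.trans hγ) hτ hw hσ hκ
  set R := fun n => ((M n).p : ℝ) * lam0 n ^ 2
      / (max ((M n).s : ℝ) 1 * Real.log (max ((M n).K : ℝ) 2)) with hR
  have hlog2 : 0 < Real.log 2 := Real.log_pos one_lt_two
  have hbig : ∀ᶠ n in atTop, (M n).delta0 (lasso n) (min 1 a2) (lam n)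
      + (M n).delta1 a1 (lam n) + (M n).delta2 γ (lam n)
      ≤ 8 * Real.exp ((4 - b / 2 * R n) * Real.log 2) := by
    -- Beyond this threshold `4 - b / 2 * R n` is nonpositive, so `log m` may be lowered to the
    -- constant `log 2`.
    filter_upwards [hrate.eventually_ge_atTop (8 / b)] with n hn
    have hn' : 4 ≤ b / 2 * R n := by
      rw [div_le_iff₀ hb0] at hn
      have : (8 : ℝ) ≤ R n * b := hn
      linarith
    refine ((M n).delta_sum_le hc ha1 ha2 (hlam0 n) hτ hσmin hw hσ hκ (hlasso n) (hlam n) (hsig n)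
      (h n) (hsub n) (hL n) (hRE n) hb).trans ?_
    set m := max ((M n).K : ℝ) 2 with hm
    have hm2 : 2 ≤ m := le_max_right _ _
    have hK : ((M n).K : ℝ) ≤ m := le_max_left _ _
    have hlogm : Real.log 2 ≤ Real.log m := Real.log_le_log two_pos hm2
    have hs0 : (0 : ℝ) ≤ (M n).s := Nat.cast_nonneg _
    set S := max ((M n).s : ℝ) 1 with hS
    have hS1 : 1 ≤ S := le_max_right _ _
    have hsS : ((M n).s : ℝ) + 1 ≤ 2 * S := by
      have := le_max_left ((M n).s : ℝ) 1
      linarith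
    have hpoly : ((M n).K + 1 : ℝ) ^ 2 ≤ Real.exp (4 * Real.log m) := by
      have e : Real.exp (4 * Real.log m) = m ^ 4 := by
        rw [← Real.rpow_natCast m 4, Real.rpow_def_of_pos (by linarith)]
        congr 1; push_cast; ring
      rw [e]
      have h1 : ((M n).K + 1 : ℝ) ≤ m ^ 2 := by nlinarith
      calc _ ≤ (m ^ 2) ^ 2 := pow_le_pow_left₀ (by positivity) h1 2
        _ = _ := by ring
    have hpR : ((M n).p : ℝ) * lam0 n ^ 2 = R n * (S * Real.log m) := by
      have h1 : 0 < S := by linarith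
      have h2 : 0 < Real.log m := by linarith
      simp only [hR]
      rw [← hm, ← hS, div_mul_cancel₀]
      positivity
    have hx : b / 2 * R n * Real.log m
        ≤ b * ((M n).p * lam0 n ^ 2 / (((M n).s : ℝ) + 1)) := by
      have h1 : (M n).p * lam0 n ^ 2 / (2 * S) ≤ (M n).p * lam0 n ^ 2 / (((M n).s : ℝ) + 1) := by
        gcongr
      have h2 : (M n).p * lam0 n ^ 2 / (2 * S) = R n * Real.log m / 2 := by
        rw [hpR]; field_simp
      rw [h2] at h1
      nlinarith
    calc _ ≤ 8 * Real.exp (4 * Real.log m) * Real.exp (-(b / 2 * R n * Real.log m)) := by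
          gcongr
      _ = 8 * Real.exp ((4 - b / 2 * R n) * Real.log m) := by
          rw [mul_assoc, ← Real.exp_add]; congr 2; ring
      _ ≤ _ := by
          refine mul_le_mul_of_nonneg_left (Real.exp_le_exp.2 ?_) (by norm_num)
          nlinarith
  refine squeeze_zero' (Eventually.of_forall fun n => ?_) hbig ?_
  · have := (M n).delta0_nonneg (lasso n) (min 1 a2) (lam n)
    have := (M n).delta1_nonneg a1 (lam n)
    have := (M n).delta2_nonneg γ (lam n)
    positivity
  · have h1 : Tendsto (fun n => b / 2 * R n) atTop atTop :=
      hrate.const_mul_atTop (by positivity)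
    have h2 : Tendsto (fun n => (4 - b / 2 * R n) * Real.log 2) atTop atBot := by
      refine Tendsto.atBot_mul_const hlog2 ?_
      exact tendsto_atBot_add_const_left _ 4 (tendsto_neg_atTop_atBot.comp h1)
    simpa using (Real.tendsto_exp_atBot.comp h2).const_mul 8

end SCRModel

theorem theorem2 :
    -- two-step convergence of the LLA algorithm to the oracle estimator
    (∀ (Ω : Type*) [MeasurableSpace Ω] (μ : Measure Ω) [IsProbabilityMeasure μ]
      (M : SCRModel Ω μ) (a1 a2 γ lam τmin : ℝ) (pen dpen : ℝ → ℝ) (init : Ω → M.Coef),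
      0 < a1 → 0 < a2 → a2 < γ → 0 ≤ lam → 0 < τmin →
      IsFoldedConcave a1 a2 γ lam pen dpen → Measurable init →
      M.MinSignal γ lam → M.MinEigen τmin →
      ∃ A : Set Ω, MeasurableSet A ∧
        1 - M.delta0 init (min 1 a2) lam - M.delta1 a1 lam - M.delta2 γ lam ≤ μ.real A ∧
        ∀ ω ∈ A, M.LLAConvergesTo dpen (M.y ω) (init ω) (M.oracle (M.y ω))) ∧
    -- explicit bounds with the Lasso initializer; the constants depend only on `c`
    (∀ c : ℝ≥0, 0 < c →
      ∃ C1 C2 C3 C4 C5 C6 C7 C8 : ℝ,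
        0 < C1 ∧ 0 < C2 ∧ 0 < C3 ∧ 0 < C4 ∧ 0 < C5 ∧ 0 < C6 ∧ 0 < C7 ∧ 0 < C8 ∧
        ∀ (Ω : Type*) [MeasurableSpace Ω] (μ : Measure Ω) [IsProbabilityMeasure μ]
          (M : SCRModel Ω μ) (a1 a2 γ lam lam0 τmin σmin w σmax κ : ℝ) (lasso : Ω → M.Coef),
          0 < a1 → 0 < a2 → a2 < γ → 0 ≤ lam0 →
          0 < τmin → 0 < σmin → 0 < w → 0 < σmax → 0 < κ →
          Measurable lasso → (∀ ω, M.IsLasso lam0 (M.y ω) (lasso ω)) →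
          3 * √((M.s : ℝ) + 1) * lam0 / (min 1 a2 * κ) ≤ lam →
          M.MinSignal γ lam → M.MinEigen τmin → M.SubGaussian c σmin →
          M.BoundedL1 w σmax → M.RestrictedEigen κ →
          M.delta0 lasso (min 1 a2) lam ≤ M.bound0 C1 C2 w σmax lam0 ∧
          M.delta1 a1 lam ≤ M.bound1 C3 C4 C5 C6 a1 w σmax τmin lam ∧
          M.delta2 γ lam ≤ M.bound2 C7 C8 γ w σmax τmin lam) ∧
    -- the failure probabilities vanish along a sequence of models with `p → ∞`
    (∀ (Ω : ℕ → Type*) [∀ n, MeasurableSpace (Ω n)] (μ : ∀ n, Measure (Ω n))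
      [∀ n, IsProbabilityMeasure (μ n)] (M : ∀ n, SCRModel (Ω n) (μ n))
      (c : ℝ≥0) (a1 a2 γ τmin σmin w σmax κ : ℝ) (lam lam0 : ℕ → ℝ)
      (lasso : ∀ n, Ω n → (M n).Coef),
      0 < c → 0 < a1 → 0 < a2 → a2 < γ →
      0 < τmin → 0 < σmin → 0 < w → 0 < σmax → 0 < κ → (∀ n, 0 ≤ lam0 n) →
      (∀ n, Measurable (lasso n)) →
      (∀ n ω, (M n).IsLasso (lam0 n) ((M n).y ω) (lasso n ω)) →
      (∀ n, 3 * √(((M n).s : ℝ) + 1) * lam0 n / (min 1 a2 * κ) ≤ lam n) →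
      (∀ n, (M n).MinSignal γ (lam n)) → (∀ n, (M n).MinEigen τmin) →
      (∀ n, (M n).SubGaussian c σmin) → (∀ n, (M n).BoundedL1 w σmax) →
      (∀ n, (M n).RestrictedEigen κ) →
      Tendsto (fun n => (M n).p) atTop atTop →
      Tendsto (fun n => ((M n).p : ℝ) * lam0 n ^ 2
        / (max ((M n).s : ℝ) 1 * Real.log (max ((M n).K : ℝ) 2))) atTop atTop →
      Tendsto (fun n => (M n).delta0 (lasso n) (min 1 a2) (lam n)
        + (M n).delta1 a1 (lam n) + (M n).delta2 γ (lam n)) atTop (𝓝 0)) := by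
  refine ⟨?_, ?_, ?_⟩
  · intro Ω _ μ _ M a1 a2 γ lam τmin pen dpen init _ _ _ hlam hτ hpen hinit hsig h
    exact M.lla_converges_of_minEigen hlam hτ hpen hinit hsig h
  · intro c hc
    have hA := SCRModel.quadRate_pos (c := c) hc
    have hB := SCRModel.linRate_pos (c := c) hc
    refine ⟨SCRModel.quadRate c / 4, SCRModel.linRate c / 2, SCRModel.quadRate c / 4,
      SCRModel.linRate c / 2, SCRModel.quadRate c / 4, SCRModel.linRate c / 2,
      SCRModel.quadRate c, SCRModel.linRate c, by positivity, by positivity, by positivity,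
      by positivity, by positivity, by positivity, hA, hB, ?_⟩
    intro Ω _ μ _ M a1 a2 γ lam lam0 τmin σmin w σmax κ lasso ha1 ha2 _ hlam0 hτ hσmin hw hσ hκ _
      hlasso hlam hsig h hsub hL hRE
    have ha0 : 0 < min 1 a2 := lt_min one_pos ha2
    have hlam' : 0 ≤ lam := le_trans (by positivity) hlam
    exact ⟨M.delta0_le hc ha2 hlam0 hσmin hw hσ hκ hlasso hlam hsub hL hRE,
      M.delta1_le hc ha1 hlam' hτ hσmin hw hσ h hsub hL,
      M.delta2_le hc hlam' hτ hσmin hw hσ hsig h hsub hL⟩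
  · intro Ω _ μ _ M c a1 a2 γ τmin σmin w σmax κ lam lam0 lasso hc ha1 ha2 hγ hτ hσmin hw hσ hκ
      hlam0 _ hlasso hlam hsig h hsub hL hRE _ hrate
    exact SCRModel.tendsto_delta_sum M hc ha1 ha2 hγ hτ hσmin hw hσ hκ hlam0 hlasso hlam hsig h
      hsub hL hRE hrate
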